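/- Let $a\neq 1$ be a square-free integer, let $c\in\mathbb{Q}^\times$, let $L=\mathbb{Q}(\sqrt a)$, and let $K$ be a quadratic extension of $L$. Fix a basis $\omega_1,\dots,\omega_4$ of $K$ over $\mathbb{Q}$ and write $\mathbf{N}_{K/\mathbb{Q}}(\mathbf{x})=N_{K/\mathbb{Q}}(x_1\omega_1+\cdots+x_4\omega_4)$ and $\mathbf{N}_{K/L}(\mathbf{x})=N_{K/L}(x_1\omega_1+\cdots+x_4\omega_4)$ for the corresponding norm forms, which are polynomials in $x_1,\dots,x_4$ over $\mathbb{Q}$ and over $L$ respectively. Let $\Omega_{\mathbb{Q}}$ be the set of places of $\mathbb{Q}$; for $\nu\in\Omega_{\mathbb{Q}}$ let $|\cdot|_\nu$ be the usual absolute value on $\mathbb{Q}_\nu$, extended to vectors by $|\mathbf{z}|_\nu=\max_i|z_i|_\nu$. Let $S\subset\Omega_{\mathbb{Q}}$ be a finite set and let $\varepsilon>0$. Suppose that for every $\nu\in\Omega_{\mathbb{Q}}$ we are given $(t^{(\nu)},\mathbf{x}^{(\nu)})\in\mathbb{Q}_\nu\times\mathbb{Q}_\nu^4$ with $$c\bigl(1-a\,(t^{(\nu)})^2\bigr)=\mathbf{N}_{K/\mathbb{Q}}(\mathbf{x}^{(\nu)})\neq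 0.$$ Then there exist $\delta\in L$ with $c=N_{L/\mathbb{Q}}(\delta)^{-1}$ and, for every $\nu\in\Omega_{\mathbb{Q}}$, a point $(t_0^{(\nu)},\mathbf{x}_0^{(\nu)})\in\mathbb{Q}_\nu\times\mathbb{Q}_\nu^4$ with $$1+t_0^{(\nu)}\sqrt a=\delta\,\mathbf{N}_{K/L}(\mathbf{x}_0^{(\nu)})\neq 0,$$ such that $$|t^{(\nu)}-t_0^{(\nu)}|_\nu<\varepsilon,\qquad |\mathbf{x}^{(\nu)}-\mathbf{x}_0^{(\nu)}|_\nu<\varepsilon\qquad\text{for every }\nu\in S.$$ Here the last equation is an identity in $L\otimes_{\mathbb{Q}}\mathbb{Q}_\nu=\mathbb{Q}_\nu\oplus\mathbb{Q}_\nu\sqrt a$ (that is, a pair of polynomial equations over $\mathbb{Q}_\nu$), and "$\neq 0$" means that the element is non-zero in every field factor of $L\otimes_{\mathbb{Q}}\mathbb{Q}_\nu$, i.e. that it is invertible. -/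

import Mathlib

open scoped TensorProduct

noncomputable section

/-- The norm form attached to a finite free extension `E / F` and a family `ω` of elements of `E`:
the polynomial `N_{E/F}(∑ i, X i * ω i)` with coefficients in `F`, i.e. the norm of the generic
element `∑ i, X i * ω i` of `F[X] ⊗ E` over `F[X]`. -/
def normForm (F : Type*) {E : Type*} [CommRing F] [CommRing E] [Algebra F E]
    {ι : Type*} [Fintype ι] (ω : ι → E) : MvPolynomial ι F :=
  Algebra.norm (MvPolynomial ι F)
    (∑ i, (MvPolynomial.X i : MvPolynomial ι F) ⊗ₜ[F] ω i)

/-- The places of `ℚ`: the real place and one finite place for each prime number. -/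
inductive RatPlace : Type
  | infinite : RatPlace
  | finite (p : Nat.Primes) : RatPlace

instance RatPlace.instFactPrime (p : Nat.Primes) : Fact (p : ℕ).Prime := ⟨p.2⟩

/-- The completion of `ℚ` at a place: `ℝ`, respectively `ℚ_p`. -/
def RatPlace.Completion : RatPlace → Type
  | .infinite => ℝ
  | .finite p => ℚ_[(p : ℕ)]

/-- The completion carries its usual absolute value (the real one, respectively the `p`-adic one
with `|p| = 1 / p`). -/
instance RatPlace.instNormedFieldCompletion (v : RatPlace) : NormedField v.Completion :=
  match v with
  | .infinite => inferInstanceAs (NormedField ℝ)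
  | .finite p => inferInstanceAs (NormedField ℚ_[(p : ℕ)])

instance RatPlace.instCharZeroCompletion (v : RatPlace) : CharZero v.Completion :=
  match v with
  | .infinite => inferInstanceAs (CharZero ℝ)
  | .finite p => inferInstanceAs (CharZero ℚ_[(p : ℕ)])

/-- `(t, x)` is a solution over the field `A ⊇ ℚ` of `c * (1 - a * t ^ 2) = N_{K/ℚ}(x) ≠ 0`,
the norm form being taken with respect to `ω`. -/
def IsNormSolution {K : Type*} [Field K] [CharZero K] {ι : Type*} [Fintype ι]
    (a : ℤ) (c : ℚ) (ω : ι → K)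
    {A : Type*} [Field A] [CharZero A] (t : A) (x : ι → A) : Prop :=
  (c : A) * (1 - (a : A) * t ^ 2) = MvPolynomial.aeval x (normForm ℚ ω) ∧
    (c : A) * (1 - (a : A) * t ^ 2) ≠ 0

/-- `(t, x)` is a solution over the field `A ⊇ ℚ` of `1 + t * √a = δ * N_{K/L}(x) ≠ 0`, where
`r = √a ∈ L = ℚ(√a)`. Both sides are elements of `L ⊗ A = A ⊕ A √a`, so that the equation is a pair
of polynomial equations over `A` for `(t, x)`. The condition `≠ 0` is that `1 + t * √a` be
invertible, i.e. that it be non-zero in each field that is a factor of `L ⊗ A`. -/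
def IsRelNormSolution {L K : Type*} [Field L] [CharZero L] [Field K] [Algebra L K]
    {ι : Type*} [Fintype ι] (r δ : L) (ω : ι → K)
    {A : Type*} [Field A] [CharZero A] (t : A) (x : ι → A) : Prop :=
  (1 + r ⊗ₜ[ℚ] t : L ⊗[ℚ] A) =
      (δ ⊗ₜ[ℚ] (1 : A)) *
        MvPolynomial.aeval (fun i => (1 : L) ⊗ₜ[ℚ] x i : ι → L ⊗[ℚ] A) (normForm L ω) ∧
    IsUnit (1 + r ⊗ₜ[ℚ] t : L ⊗[ℚ] A)

end

/-! Write σ for the conjugation of L and K = L(√β), so that N_{K/L} becomes X² - βY² in suitable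
L-coordinates. The local equation reads c·N(1 + t√a) = N(X² - βY²) with N the norm from L, so c is a
norm from L at every place. The Hasse norm principle for L, obtained here from Legendre's theorem on
ternary forms, gives δ₀ with N(δ₀) = c⁻¹ (`exists_norm_eq_inv_of_local`).

At each place the quotient z = δ₀(X² - βY²)/(1 + t√a) then has norm 1, so z = w/σ(w) by Hilbert 90.
Let S' consist of S, the real place, 2 and the primes where a, c or β is bad. Weak approximation
yields a global w close to these local ones on S'; since elements near 1 are squares of elements
near 1, w/σ(w) = z·s² with s near 1 (`RatPlace.exists_eventually_eq_mul_star_mul_sq`). Put δ =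
δ₀σ(w)/w. On S' this gives 1 + t√a = δ·N_{K/L}(s·x): the value t is kept exactly and x is moved only
slightly.

Outside S' no approximation is needed, and `Padic.exists_relNorm_of_units` solves the equation
directly. It needs only N(δ) to be a unit, which holds because N(δ) = c⁻¹ whatever w is. The two
halves are joined in `exists_adelic_relNorm_solution`; the rest translates between the abstract norm
forms and X² - βY². -/

/-! ### Legendre's theorem and the Hasse norm principle for ℚ(√a). -/

/-- The ternary form `x² - a y² - b z²` represents zero non-trivially over `k`. -/
def HasTernaryZero {k : Type*} [Field k] (a b : k) : Prop :=
  ∃ x y z : k, (x ≠ 0 ∨ y ≠ 0 ∨ z ≠ 0) ∧ x ^ 2 = a * y ^ 2 + b * z ^ 2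

namespace HasTernaryZero

variable {k : Type*} [Field k] {a b : k}

theorem symm (h : HasTernaryZero a b) : HasTernaryZero b a := by
  obtain ⟨x, y, z, h0, h⟩ := h
  exact ⟨x, z, y, by tauto, by rw [h]; ring⟩

/-- The descent step: multiply x + y√a, of norm bz², by t + √a, of norm bb'. The product has norm
b'(bz)². This works over any field, so it transports both the local hypotheses and the global
conclusion. -/
theorem of_mul_eq {b' t : k} (h : HasTernaryZero a b) (hbb : b * b' = t ^ 2 - a)
    (h0 : b * b' ≠ 0) : HasTernaryZero a b' := by
  obtain ⟨x, y, z, hn, h⟩ := h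
  refine ⟨x * t + a * y, x + t * y, b * z, ?_, by linear_combination (t ^ 2 - a) * h - b * z ^ 2 * hbb⟩
  by_contra! hc
  obtain ⟨h1, h2, h3⟩ := hc
  have hz : z = 0 := (mul_eq_zero.1 h3).resolve_left (left_ne_zero_of_mul h0)
  have hy : y = 0 := by
    have : (b * b') * y = 0 := by rw [hbb]; linear_combination t * h2 - h1
    exact (mul_eq_zero.1 this).resolve_left h0
  have hx : x = 0 := by simpa [hy] using h2
  tauto

theorem of_mul_sq {m : k} (hm : m ≠ 0) (h : HasTernaryZero a (b * m ^ 2)) :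
    HasTernaryZero a b := by
  obtain ⟨x, y, z, hn, h⟩ := h
  refine ⟨x, y, m * z, ?_, by rw [h]; ring⟩
  simpa [hm] using hn

theorem mul_sq {m : k} (hm : m ≠ 0) (h : HasTernaryZero a b) :
    HasTernaryZero a (b * m ^ 2) := by
  refine of_mul_sq (m := m⁻¹) (inv_ne_zero hm) ?_
  convert h using 1
  field_simp

end HasTernaryZero

/-- Divide a zero by its coordinate of largest absolute value. -/
theorem Padic.exists_primitive_ternaryZero {p : ℕ} [Fact p.Prime] {a b : ℤ}
    (h : HasTernaryZero (a : ℚ_[p]) b) :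
    ∃ x y z : ℤ_[p], (x = 1 ∨ y = 1 ∨ z = 1) ∧ x ^ 2 = a * y ^ 2 + b * z ^ 2 := by
  obtain ⟨x, y, z, hn, h⟩ := h
  have key : ∀ m : ℚ_[p], ‖x‖ ≤ ‖m‖ → ‖y‖ ≤ ‖m‖ → ‖z‖ ≤ ‖m‖ → (m = x ∨ m = y ∨ m = z) →
      ∃ x y z : ℤ_[p], (x = 1 ∨ y = 1 ∨ z = 1) ∧ x ^ 2 = a * y ^ 2 + b * z ^ 2 := by
    intro m hx hy hz hmem
    have hm : m ≠ 0 := by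
      rintro rfl
      rw [norm_zero, norm_le_zero_iff] at hx hy hz
      tauto
    have hb : ∀ u : ℚ_[p], ‖u‖ ≤ ‖m‖ → ∃ w : ℤ_[p], (w : ℚ_[p]) = u / m := fun u hu =>
      ⟨⟨u / m, by rw [norm_div]; exact div_le_one_of_le₀ hu (norm_nonneg _)⟩, rfl⟩
    obtain ⟨X, hX⟩ := hb x hx
    obtain ⟨Y, hY⟩ := hb y hy
    obtain ⟨Z, hZ⟩ := hb z hz
    refine ⟨X, Y, Z, ?_, ?_⟩
    · have h1 : ∀ w : ℤ_[p], (w : ℚ_[p]) = m / m → w = 1 := fun w hw =>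
        PadicInt.ext (by rw [hw, div_self hm, PadicInt.coe_one])
      rcases hmem with rfl | rfl | rfl
      exacts [.inl (h1 X hX), .inr (.inl (h1 Y hY)), .inr (.inr (h1 Z hZ))]
    · apply PadicInt.ext
      push_cast
      rw [hX, hY, hZ]
      field_simp
      exact h
  rcases le_total ‖x‖ ‖y‖ with h1 | h1 <;> rcases le_total ‖y‖ ‖z‖ with h2 | h2 <;>
    rcases le_total ‖x‖ ‖z‖ with h3 | h3
  · exact key z h3 h2 le_rfl (by simp)
  · exact key z (h1.trans h2) h2 le_rfl (by simp)
  · exact key y h1 le_rfl h2 (by simp)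
  · exact key y h1 le_rfl h2 (by simp)
  · exact key z h3 h2 le_rfl (by simp)
  · exact key x le_rfl h1 h3 (by simp)
  · exact key x le_rfl h1 (h2.trans h1) (by simp)
  · exact key x le_rfl h1 h3 (by simp)

theorem PadicInt.toZMod_eq_zero_iff_dvd {p : ℕ} [Fact p.Prime] {x : ℤ_[p]} :
    PadicInt.toZMod x = 0 ↔ (p : ℤ_[p]) ∣ x := by
  rw [← RingHom.mem_ker, PadicInt.ker_toZMod, PadicInt.maximalIdeal_eq_span_p,
    Ideal.mem_span_singleton]

/-- Modulo p a primitive zero satisfies x² = ay². If p divided y, it would divide x, so p² would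
divide bz²; as b is squarefree, p would divide z too, against primitivity. -/
theorem isSquare_zmod_of_hasTernaryZero {p : ℕ} [Fact p.Prime] {a b : ℤ} (hb : Squarefree b)
    (hpb : (p : ℤ) ∣ b) (h : HasTernaryZero (a : ℚ_[p]) b) : IsSquare (a : ZMod p) := by
  obtain ⟨x, y, z, h1, h⟩ := Padic.exists_primitive_ternaryZero h
  have hp : Prime (p : ℤ) := Nat.prime_iff_prime_int.1 Fact.out
  have hb0 : ((b : ℤ) : ZMod p) = 0 := (ZMod.intCast_zmod_eq_zero_iff_dvd b p).2 hpb
  have hmod : (PadicInt.toZMod x) ^ 2 = (a : ZMod p) * (PadicInt.toZMod y) ^ 2 := by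
    have := congrArg PadicInt.toZMod h
    simpa [hb0] using this
  by_cases hy : PadicInt.toZMod y = 0
  · exfalso
    have hx : PadicInt.toZMod x = 0 := by simpa [hy] using hmod
    have hz : PadicInt.toZMod z = 0 := by
      obtain ⟨x', hx'⟩ := PadicInt.toZMod_eq_zero_iff_dvd.1 hx
      obtain ⟨y', hy'⟩ := PadicInt.toZMod_eq_zero_iff_dvd.1 hy
      obtain ⟨b', rfl⟩ := hpb
      have hp0 : (p : ℤ_[p]) ≠ 0 := by exact_mod_cast (Fact.out : p.Prime).ne_zero
      have hbz : (b' : ℤ_[p]) * z ^ 2 = p * (x' ^ 2 - a * y' ^ 2) := by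
        apply mul_left_cancel₀ hp0
        rw [hx', hy'] at h
        push_cast at h
        linear_combination -h
      have hb' : ((b' : ℤ) : ZMod p) ≠ 0 := by
        rw [Ne, ZMod.intCast_zmod_eq_zero_iff_dvd]
        intro hd
        exact hp.not_isUnit (hb p (mul_dvd_mul_left _ hd))
      have := congrArg PadicInt.toZMod hbz
      simpa [hb'] using this
    have h01 : PadicInt.toZMod (1 : ℤ_[p]) ≠ 0 := by simp
    rcases h1 with h1 | h1 | h1
    · exact h01 (h1 ▸ hx)
    · exact h01 (h1 ▸ hy)
    · exact h01 (h1 ▸ hz)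
  · refine ⟨PadicInt.toZMod x / PadicInt.toZMod y, ?_⟩
    field_simp
    exact hmod.symm

theorem ZMod.isSquare_intCast_of_squarefree {n : ℕ} (hn : Squarefree n) (a : ℤ)
    (h : ∀ p : ℕ, p.Prime → p ∣ n → IsSquare (a : ZMod p)) : IsSquare (a : ZMod n) := by
  induction n using induction_on_primes with
  | zero => exact absurd rfl hn.ne_zero
  | one => exact ⟨0, Subsingleton.elim _ _⟩
  | prime_mul p n hpp ih =>
    have hcp : p.Coprime n := by
      by_contra hc
      exact hpp.not_isUnit (hn p <| mul_dvd_mul_left p <| hpp.dvd_iff_not_coprime.mpr hc)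
    obtain ⟨x, hx⟩ := h p hpp (dvd_mul_right _ _)
    obtain ⟨y, hy⟩ := ih hn.of_mul_right fun q hq hqn => h q hq (hqn.mul_left p)
    have : IsSquare (a : ZMod p × ZMod n) :=
      ⟨(x, y), Prod.ext (by simpa using hx) (by simpa using hy)⟩
    simpa using this.map (ZMod.chineseRemainder hcp).symm

theorem Int.exists_sq_sub_eq_mul {a b : ℤ} (hb : b ≠ 0)
    (h : IsSquare (a : ZMod b.natAbs)) :
    ∃ t b' : ℤ, t ^ 2 - a = b * b' ∧ 2 * |t| ≤ |b| := by
  have : NeZero b.natAbs := ⟨Int.natAbs_ne_zero.2 hb⟩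
  obtain ⟨x, hx⟩ := h
  have hd : b ∣ x.valMinAbs ^ 2 - a := by
    rw [← Int.natAbs_dvd, ← ZMod.intCast_zmod_eq_zero_iff_dvd]
    push_cast
    rw [hx, sq, sub_self]
  obtain ⟨b', hb'⟩ := hd
  -- The representative of least absolute value gives |t| ≤ |b|/2, which makes the descent decrease.
  refine ⟨x.valMinAbs, b', hb', ?_⟩
  have := ZMod.natAbs_valMinAbs_le x
  rw [Int.abs_eq_natAbs, Int.abs_eq_natAbs]
  omega

theorem Int.exists_squarefree_mul_sq {n : ℤ} (hn : n ≠ 0) :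
    ∃ b m : ℤ, n = b * m ^ 2 ∧ Squarefree b ∧ m ≠ 0 ∧ b.natAbs ≤ n.natAbs := by
  obtain ⟨k, m, h, hk⟩ := Nat.sq_mul_squarefree n.natAbs
  have hm : m ≠ 0 := by
    rintro rfl
    simp at h
    omega
  have hn' : n = (n.sign * k) * (m : ℤ) ^ 2 := by
    conv_lhs => rw [← Int.sign_mul_natAbs n, ← h]
    push_cast; ring
  have hs : (n.sign * k : ℤ).natAbs = k := by
    rw [Int.natAbs_mul, Int.natAbs_sign_of_ne_zero hn]; simp
  refine ⟨n.sign * k, m, hn', ?_, by exact_mod_cast hm, ?_⟩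
  · rw [← Int.squarefree_natAbs, hs]; exact hk
  · rw [hs, ← h]
    exact Nat.le_mul_of_pos_left _ (by positivity)

/-- Legendre's theorem: the Hasse principle for ternary quadratic forms over `ℚ`. -/
theorem hasTernaryZero_of_local (n : ℕ) : ∀ a b : ℤ, Squarefree a → Squarefree b →
    a.natAbs + b.natAbs ≤ n →
    (∀ v : RatPlace, HasTernaryZero (a : v.Completion) (b : v.Completion)) →
    HasTernaryZero (a : ℚ) (b : ℚ) := by
  induction n with
  | zero =>
    intro a b ha hb hn
    have := ha.ne_zero
    omega
  | succ n ih =>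
    have main : ∀ a b : ℤ, Squarefree a → Squarefree b → a.natAbs ≤ b.natAbs →
        a.natAbs + b.natAbs ≤ n + 1 →
        (∀ v : RatPlace, HasTernaryZero (a : v.Completion) (b : v.Completion)) →
        HasTernaryZero (a : ℚ) (b : ℚ) := by
      intro a b ha hb hab hn hloc
      have ha0 := ha.ne_zero
      have hb0 := hb.ne_zero
      by_cases h1 : a = 1
      · exact ⟨1, 1, 0, by simp, by simp [h1]⟩
      by_cases h2 : b = 1
      · exact ⟨1, 0, 1, by simp, by simp [h2]⟩
      -- Only a = b = -1 is left here, and the real place excludes it.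
      by_cases h3 : b.natAbs = 1
      · exfalso
        obtain rfl : a = -1 := by omega
        obtain rfl : b = -1 := by omega
        obtain ⟨x, y, z, hne, h⟩ : HasTernaryZero (((-1 : ℤ) : ℝ)) ((-1 : ℤ) : ℝ) :=
          hloc .infinite
        push_cast at h
        have hx : x = 0 := by nlinarith [sq_nonneg x, sq_nonneg y, sq_nonneg z]
        have hy : y = 0 := by nlinarith [sq_nonneg x, sq_nonneg y, sq_nonneg z]
        have hz : z = 0 := by nlinarith [sq_nonneg x, sq_nonneg y, sq_nonneg z]
        tauto
      have hsq : IsSquare (a : ZMod b.natAbs) := by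
        refine ZMod.isSquare_intCast_of_squarefree (Int.squarefree_natAbs.2 hb) a ?_
        intro p hp hpb
        have : Fact p.Prime := ⟨hp⟩
        exact isSquare_zmod_of_hasTernaryZero hb (Int.natCast_dvd.2 hpb) (hloc (.finite ⟨p, hp⟩))
      obtain ⟨t, b', htb, ht⟩ := Int.exists_sq_sub_eq_mul hb0 hsq
      by_cases hb'0 : b' = 0
      · refine ⟨t, 1, 0, by simp, ?_⟩
        have : t ^ 2 = a := by simpa [hb'0, sub_eq_zero] using htb
        exact_mod_cast (by simpa using this : t ^ 2 = a * 1 ^ 2 + b * 0 ^ 2)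
      obtain ⟨b'', m, hb'', hsf, hm, -⟩ := Int.exists_squarefree_mul_sq hb'0
      have hlt : b''.natAbs < b.natAbs := by
        have hb2 : 2 ≤ |b| := by rw [Int.abs_eq_natAbs]; omega
        have habs : |a| ≤ |b| := by rw [Int.abs_eq_natAbs, Int.abs_eq_natAbs]; omega
        have e1 : |b| * |b'| ≤ |t| ^ 2 + |a| := by
          rw [← abs_mul, ← htb, ← abs_pow]; exact abs_sub _ _
        -- Otherwise b² ≤ b²/4 + |b|, which is impossible for |b| ≥ 2.
        have e2 : |b'| < |b| := by
          by_contra! hc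
          nlinarith [abs_nonneg t, abs_nonneg b, mul_le_mul_of_nonneg_left hc (abs_nonneg b)]
        have e3 : |b''| ≤ |b'| := by
          rw [hb'', abs_mul]
          have : 1 ≤ |m ^ 2| := Int.one_le_abs (pow_ne_zero _ hm)
          nlinarith [abs_nonneg b'']
        rw [Int.abs_eq_natAbs, Int.abs_eq_natAbs] at *
        omega
      have hstep := ih a b'' ha hsf (by omega) fun v => by
        refine HasTernaryZero.of_mul_sq (m := (m : v.Completion)) (by exact_mod_cast hm) ?_
        have := (hloc v).of_mul_eq (b' := (b' : v.Completion)) (t := t) (by exact_mod_cast htb.symm)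
          (by exact_mod_cast mul_ne_zero hb0 hb'0)
        rw [hb''] at this
        exact_mod_cast this
      have h' : HasTernaryZero (a : ℚ) (b' : ℚ) := by
        rw [hb'']
        exact_mod_cast hstep.mul_sq (m := (m : ℚ)) (by exact_mod_cast hm)
      refine h'.of_mul_eq (t := (t : ℚ)) ?_ ?_
      · rw [mul_comm]; exact_mod_cast htb.symm
      · exact_mod_cast mul_ne_zero hb'0 hb0
    intro a b ha hb hn hloc
    rcases le_total a.natAbs b.natAbs with h | h
    · exact main a b ha hb h hn hloc
    · exact (main b a hb ha h (by omega) fun v => (hloc v).symm).symm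

theorem Int.not_sq_eq_of_squarefree {a : ℤ} (ha : Squarefree a) (ha1 : a ≠ 1) (q : ℚ) :
    q ^ 2 ≠ a := by
  intro h
  have hsq : IsSquare (a : ℚ) := ⟨q, by rw [← h, sq]⟩
  obtain ⟨n, rfl⟩ := Rat.isSquare_intCast_iff.1 hsq
  have := Int.isUnit_iff.1 (ha n dvd_rfl)
  rcases this with rfl | rfl <;> simp at ha1

/-- The Hasse norm principle for the quadratic extension `ℚ(√a)` of `ℚ`. -/
theorem exists_sq_sub_mul_sq_eq_of_local {a : ℤ} (ha : Squarefree a) (ha1 : a ≠ 1) {c : ℚ}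
    (hc : c ≠ 0) (hloc : ∀ v : RatPlace, ∃ x y : v.Completion, (c : v.Completion) = x ^ 2 - a * y ^ 2) :
    ∃ x y : ℚ, c = x ^ 2 - a * y ^ 2 := by
  obtain ⟨b, m, hbm, hb, hm, -⟩ := Int.exists_squarefree_mul_sq (n := c.num * c.den)
    (mul_ne_zero (Rat.num_ne_zero.2 hc) (by exact_mod_cast c.den_ne_zero))
  have hden : (c.den : ℚ) ≠ 0 := by exact_mod_cast c.den_ne_zero
  have hmq : (m : ℚ) ≠ 0 := by exact_mod_cast hm
  have hcb : c = b * (m / c.den) ^ 2 := by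
    have h1 : (c.num : ℚ) * c.den = b * m ^ 2 := by exact_mod_cast hbm
    have h2 : (c.num : ℚ) = c * c.den := (Rat.mul_den_eq_num c).symm
    field_simp
    rw [← h1, h2]; ring
  set q : ℚ := m / c.den
  have hq : q ≠ 0 := div_ne_zero hmq hden
  obtain ⟨x, y, z, hne, h⟩ := hasTernaryZero_of_local _ a b ha hb le_rfl fun v => by
    refine HasTernaryZero.of_mul_sq (m := (q : v.Completion)) (by exact_mod_cast hq) ?_
    obtain ⟨x, y, h⟩ := hloc v
    refine ⟨x, y, 1, by simp, ?_⟩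
    rw [hcb] at h
    push_cast at h
    linear_combination -h
  -- A zero with z = 0 would make a a rational square.
  have hz : z ≠ 0 := by
    rintro rfl
    by_cases hy : y = 0
    · subst hy; simp at h; simp_all
    · refine Int.not_sq_eq_of_squarefree ha ha1 (x / y) ?_
      field_simp
      linear_combination h
  refine ⟨q * x / z, q * y / z, ?_⟩
  rw [hcb]
  field_simp
  linear_combination -h

/-! ### Weak approximation, Hilbert 90 and local squares. -/

section

open Filter Topology

namespace RatPlace

theorem denseRange_ratCast (v : RatPlace) : DenseRange ((↑) : ℚ → v.Completion) :=
  match v with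
  | .infinite => Rat.denseRange_cast (𝕜 := ℝ)
  | .finite p => Padic.denseRange_ratCast (p : ℕ)

/-- The absolute value of `ℚ` attached to a place. -/
noncomputable def absoluteValue (v : RatPlace) : AbsoluteValue ℚ ℝ where
  toFun q := ‖(q : v.Completion)‖
  map_mul' x y := by simp
  nonneg' x := norm_nonneg _
  eq_zero' x := by simp
  add_le' x y := by simpa using norm_add_le _ _

theorem absoluteValue_apply (v : RatPlace) (q : ℚ) :
    v.absoluteValue q = ‖(q : v.Completion)‖ := rfl

theorem absoluteValue_finite_self_lt_one (p : Nat.Primes) :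
    (finite p).absoluteValue (p : ℕ) < 1 := by
  have : ‖(((p : ℕ) : ℚ) : ℚ_[(p : ℕ)])‖ < 1 := by
    rw [Rat.cast_natCast]; exact Padic.norm_p_lt_one
  exact this

theorem one_le_absoluteValue_of_ne {v : RatPlace} {p : Nat.Primes} (h : v ≠ finite p) :
    1 ≤ v.absoluteValue (p : ℕ) := by
  cases v with
  | infinite =>
    have : (1 : ℝ) ≤ ‖(((p : ℕ) : ℚ) : ℝ)‖ := by
      rw [Rat.cast_natCast, Real.norm_natCast]
      exact_mod_cast p.2.one_lt.le
    exact this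
  | finite q =>
    have : (1 : ℝ) ≤ ‖(((p : ℕ) : ℚ) : ℚ_[(q : ℕ)])‖ := by
      rw [Rat.cast_natCast]
      refine (Padic.norm_natCast_eq_one_iff.2 ?_).ge
      refine (Nat.coprime_primes q.2 p.2).2 fun hqp => h ?_
      rw [Subtype.ext hqp]
    exact this

/-- The prime p itself separates places: its absolute value is below 1 at p and at least 1 at every
other place. -/
theorem absoluteValue_not_isEquiv {v w : RatPlace} (h : v ≠ w) :
    ¬ v.absoluteValue.IsEquiv w.absoluteValue := by
  intro he
  cases v with
  | finite p =>
    exact (one_le_absoluteValue_of_ne h.symm).not_gt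
      (he.lt_one_iff.1 (absoluteValue_finite_self_lt_one p))
  | infinite =>
    cases w with
    | infinite => exact h rfl
    | finite p =>
      exact (one_le_absoluteValue_of_ne h).not_gt
        (he.lt_one_iff.2 (absoluteValue_finite_self_lt_one p))

theorem absoluteValue_isNontrivial (v : RatPlace) : v.absoluteValue.IsNontrivial := by
  cases v with
  | finite p =>
    exact ⟨(p : ℕ), by exact_mod_cast p.2.ne_zero, (absoluteValue_finite_self_lt_one p).ne⟩
  | infinite =>
    refine ⟨2, two_ne_zero, ?_⟩
    have : ‖((2 : ℚ) : ℝ)‖ ≠ 1 := by norm_num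
    exact this

/-- Weak approximation for `ℚ`. -/
theorem exists_rat_forall_mem (S : Finset RatPlace) (y : ∀ v : RatPlace, v.Completion)
    (U : ∀ v : RatPlace, Set v.Completion) (hU : ∀ v ∈ S, U v ∈ 𝓝 (y v)) :
    ∃ q : ℚ, ∀ v ∈ S, (q : v.Completion) ∈ U v := by
  -- The approximation theorem applied below concerns copies of ℚ, not completions, so each target
  -- is first replaced by a nearby rational.
  have h1 : ∀ v : S, ∃ ε > 0, ∃ z : ℚ, Metric.ball (z : v.1.Completion) ε ⊆ U v := by
    rintro ⟨v, hv⟩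
    obtain ⟨ε, hε, hball⟩ := Metric.mem_nhds_iff.1 (hU v hv)
    obtain ⟨z, hz⟩ := Metric.denseRange_iff.1 v.denseRange_ratCast (y v) (ε / 2) (half_pos hε)
    refine ⟨ε / 2, half_pos hε, z, fun x hx => hball ?_⟩
    rw [Metric.mem_ball] at hx ⊢
    rw [dist_comm] at hz
    linarith [dist_triangle x z (y v)]
  choose ε hε z hz using h1
  have hd := AbsoluteValue.denseRange_algebraMap_pi (v := fun v : S => v.1.absoluteValue)
    (fun v => v.1.absoluteValue_isNontrivial)
    (fun v w hvw => absoluteValue_not_isEquiv fun h => hvw (Subtype.ext h))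
  have hV : Set.pi Set.univ (fun v : S => Metric.ball (WithAbs.toAbs v.1.absoluteValue (z v)) (ε v))
      ∈ 𝓝 (fun v : S => WithAbs.toAbs v.1.absoluteValue (z v)) :=
    set_pi_mem_nhds Set.finite_univ fun v _ => Metric.ball_mem_nhds _ (hε v)
  obtain ⟨_, hx, q, rfl⟩ := mem_closure_iff_nhds.1 (hd _) _ hV
  refine ⟨q, fun v hv => hz ⟨v, hv⟩ ?_⟩
  have h2 := hx ⟨v, hv⟩ trivial
  rw [Metric.mem_ball, dist_eq_norm] at h2 ⊢
  have h3 : ‖WithAbs.toAbs v.absoluteValue (q - z ⟨v, hv⟩)‖ < ε ⟨v, hv⟩ := h2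
  rw [WithAbs.norm_toAbs_eq, absoluteValue_apply] at h3
  simpa using h3

theorem exists_rat_prod_forall_mem (S : Finset RatPlace)
    (y : ∀ v : RatPlace, v.Completion × v.Completion)
    (U : ∀ v : RatPlace, Set (v.Completion × v.Completion)) (hU : ∀ v ∈ S, U v ∈ 𝓝 (y v)) :
    ∃ q r : ℚ, ∀ v ∈ S, ((q : v.Completion), (r : v.Completion)) ∈ U v := by
  have : ∀ v : RatPlace, ∃ V W : Set v.Completion, v ∈ S →
      V ∈ 𝓝 (y v).1 ∧ W ∈ 𝓝 (y v).2 ∧ V ×ˢ W ⊆ U v := by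
    intro v
    by_cases hv : v ∈ S
    · obtain ⟨V, hV, W, hW, h⟩ := mem_nhds_prod_iff.1 (hU v hv)
      exact ⟨V, W, fun _ => ⟨hV, hW, h⟩⟩
    · exact ⟨∅, ∅, fun h => absurd h hv⟩
  choose V W h using this
  obtain ⟨q, hq⟩ := exists_rat_forall_mem S (fun v => (y v).1) V fun v hv => (h v hv).1
  obtain ⟨r, hr⟩ := exists_rat_forall_mem S (fun v => (y v).2) W fun v hv => (h v hv).2.1
  exact ⟨q, r, fun v hv => (h v hv).2.2 ⟨hq v hv, hr v hv⟩⟩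

end RatPlace

/-- The map is squaring in 𝕜[√a]. Its derivative at 1 is multiplication by 2, hence surjective, so
squaring is open at 1. -/
theorem map_quadratic_sq_nhds {𝕜 : Type*} [NontriviallyNormedField 𝕜] [CompleteSpace 𝕜]
    [CharZero 𝕜] (a : 𝕜) :
    map (fun s : 𝕜 × 𝕜 => (s.1 * s.1 + a * s.2 * s.2, s.1 * s.2 + s.2 * s.1)) (𝓝 (1, 0)) =
      𝓝 (1, 0) := by
  have h : HasStrictFDerivAt
      (fun s : 𝕜 × 𝕜 => (s.1 * s.1 + a * s.2 * s.2, s.1 * s.2 + s.2 * s.1))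
      ((2 : 𝕜) • ContinuousLinearMap.id 𝕜 (𝕜 × 𝕜)) (1, 0) := by
    have h1 : HasStrictFDerivAt (fun s : 𝕜 × 𝕜 => s.1) (ContinuousLinearMap.fst 𝕜 𝕜 𝕜) (1, 0) :=
      hasStrictFDerivAt_fst
    have h2 : HasStrictFDerivAt (fun s : 𝕜 × 𝕜 => s.2) (ContinuousLinearMap.snd 𝕜 𝕜 𝕜) (1, 0) :=
      hasStrictFDerivAt_snd
    refine (((h1.mul h1).add ((h2.const_mul a).mul h2)).prodMk
      ((h1.mul h2).add (h2.mul h1))).congr_fderiv ?_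
    ext <;> simp <;> norm_num
  have := h.map_nhds_eq_of_surj (by
    rw [LinearMap.range_eq_top]
    intro y
    exact ⟨(2 : 𝕜)⁻¹ • y, by simp⟩)
  simpa using this

theorem RatPlace.map_quadratic_sq_nhds (v : RatPlace) (a : v.Completion) :
    map (fun s : v.Completion × v.Completion =>
      (s.1 * s.1 + a * s.2 * s.2, s.1 * s.2 + s.2 * s.1)) (𝓝 (1, 0)) = 𝓝 (1, 0) :=
  match v with
  | .infinite => _root_.map_quadratic_sq_nhds (𝕜 := ℝ) a
  | .finite p => _root_.map_quadratic_sq_nhds (𝕜 := ℚ_[(p : ℕ)]) a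

open QuadraticAlgebra in
/-- Hilbert 90 for `A[√a]`. -/
theorem QuadraticAlgebra.exists_mul_star_eq {A : Type*} [Field A] [CharZero A] {a : A}
    (ha : a ≠ 0) (z : QuadraticAlgebra A a 0) (hz : norm z = 1) :
    ∃ w : QuadraticAlgebra A a 0, norm w ≠ 0 ∧ z * star w = w := by
  obtain ⟨x, y⟩ := z
  simp [norm_def] at hz
  -- Since zσ(z) = 1, the element 1 + z satisfies zσ(1 + z) = 1 + z. Its norm is 2(1 + x), so it
  -- fails only when x = -1; then z = -1 and √a serves instead.
  by_cases h : x = -1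
  · subst h
    have hy : y = 0 := by
      have : a * (y * y) = 0 := by linear_combination -hz
      simpa [ha] using this
    subst hy
    refine ⟨ω, by simpa [norm_def] using ha, ?_⟩
    ext <;> simp
  · refine ⟨⟨1 + x, y⟩, ?_, ?_⟩
    · simp only [norm_def]
      have : 1 + x ≠ 0 := fun h' => h (by linear_combination h')
      intro h0
      apply this
      have : 2 * (1 + x) = 0 := by linear_combination h0 - hz
      simpa using this
    · ext <;> simp
      · linear_combination hz
      · ring

open QuadraticAlgebra in
/-- Every element of norm one of `L ⊗ ℚ_v` is up to a square near `1` of the form `w / σ(w)` with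
`w` ranging over a neighbourhood. -/
theorem RatPlace.exists_eventually_eq_mul_star_mul_sq (v : RatPlace) {a : v.Completion} (ha : a ≠ 0)
    (z : QuadraticAlgebra v.Completion a 0) (hz : norm z = 1)
    {U : Set (v.Completion × v.Completion)} (hU : U ∈ 𝓝 (1, 0)) :
    ∃ w : v.Completion × v.Completion, ∀ᶠ w' in 𝓝 w,
      norm (⟨w'.1, w'.2⟩ : QuadraticAlgebra v.Completion a 0) ≠ 0 ∧
      ∃ s ∈ U, (⟨w'.1, w'.2⟩ : QuadraticAlgebra v.Completion a 0) =
        z * star ⟨w'.1, w'.2⟩ * ⟨s.1, s.2⟩ ^ 2 := by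
  obtain ⟨w, hw, hzw⟩ := exists_mul_star_eq ha z hz
  let N : v.Completion × v.Completion → v.Completion := fun u => u.1 * u.1 - a * u.2 * u.2
  have hN : ∀ u, norm (⟨u.1, u.2⟩ : QuadraticAlgebra v.Completion a 0) = N u := fun u => by
    simp [norm_def, N]
  -- This is u/(zσ(u)) = σ(z)u²/N(u) in coordinates. It equals 1 at w, so near w its values are
  -- squares of elements of `U`.
  let f : v.Completion × v.Completion → v.Completion × v.Completion := fun u =>
    ((z.re * (u.1 * u.1 + a * u.2 * u.2) - a * z.im * (2 * u.1 * u.2)) / N u,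
      (z.re * (2 * u.1 * u.2) - z.im * (u.1 * u.1 + a * u.2 * u.2)) / N u)
  have hNw : N (w.re, w.im) ≠ 0 := by rw [← hN]; exact hw
  have hzN : z.re * z.re - a * z.im * z.im = 1 := by rw [← hz, norm_def]; ring
  have hNc : Continuous N := by fun_prop
  have hfc : ContinuousAt f (w.re, w.im) := by
    refine ContinuousAt.prodMk ?_ ?_ <;> refine ContinuousAt.div ?_ hNc.continuousAt hNw <;> fun_prop
  have hre : z.re * w.re - a * z.im * w.im = w.re := by
    have := congrArg QuadraticAlgebra.re hzw
    simp at this; linear_combination this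
  have him : z.im * w.re - z.re * w.im = w.im := by
    have := congrArg QuadraticAlgebra.im hzw
    simp at this; linear_combination this
  have hf1 : f (w.re, w.im) = (1, 0) := by
    refine Prod.ext ((div_eq_one_iff_eq hNw).2 ?_) (div_eq_zero_iff.2 (.inl ?_))
    · simp only [N]; linear_combination w.re * hre - a * w.im * him
    · simp only; linear_combination w.im * hre - w.re * him
  have hsq := v.map_quadratic_sq_nhds a
  have hev : ∀ᶠ u in 𝓝 (w.re, w.im), f u ∈ (fun s : v.Completion × v.Completion =>
      (s.1 * s.1 + a * s.2 * s.2, s.1 * s.2 + s.2 * s.1)) '' U := by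
    apply hfc
    rw [hf1, ← hsq]
    exact image_mem_map hU
  refine ⟨(w.re, w.im), ?_⟩
  filter_upwards [hev, hNc.continuousAt.eventually_ne hNw] with u hu hNu
  refine ⟨by rwa [hN], ?_⟩
  obtain ⟨s, hs, hsf⟩ := hu
  refine ⟨s, hs, ?_⟩
  obtain ⟨h1, h2⟩ := Prod.ext_iff.1 hsf
  simp only [f, eq_div_iff hNu] at h1 h2
  simp only [N] at h1 h2 hNu
  ext
  · simp [pow_two]
    apply mul_right_cancel₀ hNu
    linear_combination -(z.re * u.1 - a * z.im * u.2) * h1 - a * (z.im * u.1 - z.re * u.2) * h2 - u.1 * (u.1 * u.1 - a * u.2 * u.2) * hzN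
  · simp [pow_two]
    apply mul_right_cancel₀ hNu
    linear_combination -(z.re * u.1 - a * z.im * u.2) * h2 - (z.im * u.1 - z.re * u.2) * h1 - u.2 * (u.1 * u.1 - a * u.2 * u.2) * hzN

end

/-! ### Local solvability at the good primes. -/

section

section Padic

variable {p : ℕ} [Fact p.Prime]

theorem PadicInt.isSquare_of_isSquare_toZMod (hp : p ≠ 2) {x : ℤ_[p]}
    (hx : PadicInt.toZMod x ≠ 0) (h : IsSquare (PadicInt.toZMod x)) : IsSquare x := by
  obtain ⟨s, hs⟩ := h
  obtain ⟨y, rfl⟩ := ZMod.ringHom_surjective (PadicInt.toZMod (p := p)) s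
  have hy : PadicInt.toZMod y ≠ 0 := by
    intro h0; rw [h0, mul_zero] at hs; exact hx hs
  have h2 : (2 : ZMod p) ≠ 0 := by
    exact Ring.two_ne_zero (by rwa [ZMod.ringChar_zmod_n])
  have hn : ‖2 * y‖ = 1 := by
    rw [← PadicInt.isUnit_iff]
    by_contra hc
    rw [PadicInt.not_isUnit_iff, PadicInt.norm_lt_one_iff_dvd,
      ← PadicInt.toZMod_eq_zero_iff_dvd, map_mul, map_ofNat] at hc
    exact mul_ne_zero h2 hy hc
  obtain ⟨z, hz, -⟩ := hensels_lemma (p := p) (R := ℤ_[p])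
    (F := Polynomial.X ^ 2 - Polynomial.C x) (a := y) (by
      have h1 : Polynomial.aeval y (Polynomial.derivative
          (Polynomial.X ^ 2 - Polynomial.C x : Polynomial ℤ_[p])) = 2 * y := by
        simp [one_add_one_eq_two]
      rw [h1, hn, one_pow, PadicInt.norm_lt_one_iff_dvd, ← PadicInt.toZMod_eq_zero_iff_dvd]
      simp [hs, sq])
  refine ⟨z, ?_⟩
  simp at hz
  linear_combination -hz

theorem PadicInt.toZMod_ne_zero_iff {x : ℤ_[p]} : PadicInt.toZMod x ≠ 0 ↔ ‖x‖ = 1 := by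
  rw [← PadicInt.isUnit_iff, Ne, PadicInt.toZMod_eq_zero_iff_dvd, ← PadicInt.norm_lt_one_iff_dvd,
    ← PadicInt.not_isUnit_iff, not_not]

/-- Over the residue field x² - by² takes every value, by counting squares. A solution is lifted by
Hensel in one variable: in x if x is a unit, otherwise in y. -/
theorem PadicInt.exists_eq_sq_sub_mul_sq (hp : p ≠ 2) {b e : ℤ_[p]} (hb : ‖b‖ = 1)
    (he : ‖e‖ = 1) : ∃ x y : ℤ_[p], e = x ^ 2 - b * y ^ 2 := by
  have hb0 := PadicInt.toZMod_ne_zero_iff.2 hb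
  have he0 := PadicInt.toZMod_ne_zero_iff.2 he
  obtain ⟨x, y, hxy⟩ : ∃ x y : ZMod p, PadicInt.toZMod e = x ^ 2 - PadicInt.toZMod b * y ^ 2 := by
    have hodd : Fintype.card (ZMod p) % 2 = 1 := by
      rw [ZMod.card]; exact Nat.odd_iff.1 ((Fact.out : p.Prime).odd_of_ne_two hp)
    obtain ⟨x, y, h⟩ := FiniteField.exists_root_sum_quadratic
      (f := Polynomial.C 1 * Polynomial.X ^ 2 + Polynomial.C 0 * Polynomial.X +
        Polynomial.C (-PadicInt.toZMod e))
      (g := Polynomial.C (-PadicInt.toZMod b) * Polynomial.X ^ 2 + Polynomial.C 0 * Polynomial.X +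
        Polynomial.C 0)
      (Polynomial.degree_quadratic one_ne_zero) (Polynomial.degree_quadratic (neg_ne_zero.2 hb0))
      hodd
    refine ⟨x, y, ?_⟩
    simp at h
    linear_combination -h
  by_cases hx : x = 0
  · obtain ⟨u, rfl⟩ := PadicInt.isUnit_iff.2 hb
    have h1 : PadicInt.toZMod (-e * (↑u⁻¹ : ℤ_[p])) = y * y := by
      have h2 : PadicInt.toZMod (u : ℤ_[p]) * PadicInt.toZMod (↑u⁻¹ : ℤ_[p]) = 1 := by
        rw [← map_mul, Units.mul_inv, map_one]
      rw [map_mul, map_neg, hxy, hx]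
      linear_combination y * y * h2
    obtain ⟨z, hz⟩ := PadicInt.isSquare_of_isSquare_toZMod hp (x := -e * (↑u⁻¹ : ℤ_[p]))
      (by rw [PadicInt.toZMod_ne_zero_iff]; simp [he]) ⟨y, h1⟩
    refine ⟨0, z, ?_⟩
    have h3 : (u : ℤ_[p]) * (↑u⁻¹ : ℤ_[p]) = 1 := Units.mul_inv u
    linear_combination -u * hz - e * h3
  · obtain ⟨w, rfl⟩ := ZMod.ringHom_surjective (PadicInt.toZMod (p := p)) y
    have h1 : PadicInt.toZMod (e + b * w ^ 2) = x * x := by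
      simp only [map_add, map_mul, map_pow, hxy]; ring
    obtain ⟨z, hz⟩ := PadicInt.isSquare_of_isSquare_toZMod hp
      (by rw [h1]; exact mul_ne_zero hx hx) ⟨x, h1⟩
    exact ⟨z, w, by linear_combination hz⟩

theorem Padic.exists_eq_sq_sub_mul_sq (hp : p ≠ 2) {b e : ℚ_[p]} (hb : ‖b‖ = 1) {k : ℤ}
    (he : ‖e‖ = (p : ℝ) ^ (2 * k)) : ∃ x y : ℚ_[p], e = x ^ 2 - b * y ^ 2 := by
  have hp0 : (p : ℚ_[p]) ≠ 0 := by exact_mod_cast (Fact.out : p.Prime).ne_zero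
  have hpR : (p : ℝ) ≠ 0 := by exact_mod_cast (Fact.out : p.Prime).ne_zero
  have hn : ‖e * ((p : ℚ_[p]) ^ k) ^ 2‖ = 1 := by
    rw [norm_mul, he, norm_pow, Padic.norm_p_zpow, ← zpow_natCast, ← zpow_mul, ← zpow_add₀ hpR]
    ring_nf
    simp
  obtain ⟨x, y, h⟩ := PadicInt.exists_eq_sq_sub_mul_sq hp (b := ⟨b, hb.le⟩)
    (e := ⟨_, hn.le⟩) hb hn
  have h' := congrArg (fun z : ℤ_[p] => (z : ℚ_[p])) h
  push_cast at h'
  change e * ((p : ℚ_[p]) ^ k) ^ 2 = (x : ℚ_[p]) ^ 2 - b * (y : ℚ_[p]) ^ 2 at h'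
  refine ⟨x / (p : ℚ_[p]) ^ k, y / (p : ℚ_[p]) ^ k, ?_⟩
  have hpk : (p : ℚ_[p]) ^ k ≠ 0 := zpow_ne_zero _ hp0
  field_simp
  exact h'

end Padic

namespace QuadraticAlgebra

/-- The homomorphism `A[√a] → A` attached to a square root of `a` in `A`. -/
def evalRoot {A : Type*} [CommRing A] {a : A} (θ : A) (hθ : θ ^ 2 = a) :
    QuadraticAlgebra A a 0 →+* A where
  toFun z := z.re + θ * z.im
  map_one' := by simp
  map_zero' := by simp
  map_add' x y := by simp; ring
  map_mul' x y := by subst hθ; simp; ring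

theorem evalRoot_apply {A : Type*} [CommRing A] {a : A} (θ : A) (hθ : θ ^ 2 = a)
    (z : QuadraticAlgebra A a 0) : evalRoot θ hθ z = z.re + θ * z.im := rfl

theorem evalRoot_mul_evalRoot_neg {A : Type*} [CommRing A] {a θ : A} (hθ : θ ^ 2 = a) (z : QuadraticAlgebra A a 0) :
    evalRoot θ hθ z * evalRoot (-θ) (by rw [neg_sq, hθ]) z = norm z := by
  simp only [evalRoot_apply, norm_def]; linear_combination -z.im ^ 2 * hθ

variable {A : Type*} [Field A] [CharZero A] {a θ : A}

theorem eq_of_evalRoot_eq (hθ : θ ^ 2 = a) (hθ0 : θ ≠ 0) {z w : QuadraticAlgebra A a 0}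
    (h1 : evalRoot θ hθ z = evalRoot θ hθ w)
    (h2 : evalRoot (-θ) (by rw [neg_sq, hθ]) z = evalRoot (-θ) (by rw [neg_sq, hθ]) w) :
    z = w := by
  simp only [evalRoot_apply] at h1 h2
  have hre : z.re = w.re := by linear_combination (h1 + h2) / 2
  ext
  · exact hre
  · refine mul_left_cancel₀ hθ0 ?_
    linear_combination h1 - hre

theorem exists_evalRoot_eq (hθ : θ ^ 2 = a) (hθ0 : θ ≠ 0) (u v : A) :
    ∃ z : QuadraticAlgebra A a 0, evalRoot θ hθ z = u ∧
      evalRoot (-θ) (by rw [neg_sq, hθ]) z = v := by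
  refine ⟨⟨(u + v) / 2, (u - v) / (2 * θ)⟩, ?_, ?_⟩ <;> simp only [evalRoot_apply] <;> field_simp <;>
    ring

end QuadraticAlgebra

open QuadraticAlgebra hiding norm_neg norm_zero norm_one

section Padic

variable {p : ℕ} [Fact p.Prime] {a : ℚ_[p]}

/-- The local equation `1 + t √a = δ (X² - B Y²)` is solvable at primes that split in `ℚ(√a)` and
at which `a`, `B` and the norm of `δ` are units. -/
theorem Padic.exists_relNorm_of_split (hp : p ≠ 2) {θ : ℚ_[p]} (hθ : θ ^ 2 = a) (ha : ‖a‖ = 1)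
    {B δ : QuadraticAlgebra ℚ_[p] a 0} (hB1 : ‖B.re‖ ≤ 1) (hB2 : ‖B.im‖ ≤ 1)
    (hB : ‖norm B‖ = 1) (hδ : ‖norm δ‖ = 1) :
    ∃ (t : ℚ_[p]) (X Y : QuadraticAlgebra ℚ_[p] a 0), ⟨1, t⟩ = δ * (X ^ 2 - B * Y ^ 2) ∧
      norm (⟨1, t⟩ : QuadraticAlgebra ℚ_[p] a 0) ≠ 0 := by
  have hθn : ‖θ‖ = 1 := by
    rw [← hθ, norm_pow] at ha
    exact (pow_eq_one_iff_of_nonneg (norm_nonneg _) two_ne_zero).1 ha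
  have hθ0 : θ ≠ 0 := by rintro rfl; simp at hθn
  have hθ' : (-θ) ^ 2 = a := by rw [neg_sq, hθ]
  have hle : ∀ η : ℚ_[p], ∀ hη : η ^ 2 = a, ‖η‖ = 1 → ‖evalRoot η hη B‖ ≤ 1 := fun η hη h1 => by
    rw [evalRoot_apply]
    refine (Padic.nonarchimedean _ _).trans (max_le hB1 ?_)
    rw [norm_mul, h1, one_mul]; exact hB2
  have hmul : ‖evalRoot θ hθ B‖ * ‖evalRoot (-θ) hθ' B‖ = 1 := by
    rw [← norm_mul, evalRoot_mul_evalRoot_neg hθ, hB]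
  have hl1 := hle θ hθ hθn
  have hl2 := hle (-θ) hθ' (by rwa [norm_neg])
  -- Both components of B are integral and their product is a unit, so each is a unit.
  have hb1 : ‖evalRoot θ hθ B‖ = 1 := by nlinarith [norm_nonneg (evalRoot θ hθ B)]
  have hb2 : ‖evalRoot (-θ) hθ' B‖ = 1 := by rwa [hb1, one_mul] at hmul
  have hdmul : ‖evalRoot θ hθ δ‖ * ‖evalRoot (-θ) hθ' δ‖ = 1 := by
    rw [← norm_mul, evalRoot_mul_evalRoot_neg hθ, hδ]
  have hpR : (p : ℝ) ≠ 0 := by exact_mod_cast (Fact.out : p.Prime).ne_zero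
  have hp0 : (p : ℚ_[p]) ≠ 0 := by exact_mod_cast (Fact.out : p.Prime).ne_zero
  set d₁ := evalRoot θ hθ δ
  set d₂ := evalRoot (-θ) hθ' δ
  have hd1 : d₁ ≠ 0 := by intro h; simp [h] at hdmul
  have hd2 : d₂ ≠ 0 := by intro h; simp [h] at hdmul
  obtain ⟨n, hn⟩ : ∃ n : ℤ, ‖d₁‖ = (p : ℝ) ^ n := ⟨_, Padic.norm_eq_zpow_neg_valuation hd1⟩
  have hn2 : ‖d₂‖ = (p : ℝ) ^ (-n) := by
    rw [zpow_neg, ← hn]; exact eq_inv_of_mul_eq_one_right hdmul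
  -- In ℚ_p × ℚ_p the equation splits into two, each solvable as soon as (1 ± θt)/dᵢ has even
  -- valuation. The valuations of d₁ and d₂ are opposite, so they have the same parity.
  have key : ∀ t : ℚ_[p], ∀ k l : ℤ, ‖(1 + θ * t) / d₁‖ = (p : ℝ) ^ (2 * k) →
      ‖(1 + -θ * t) / d₂‖ = (p : ℝ) ^ (2 * l) →
      ∃ (t : ℚ_[p]) (X Y : QuadraticAlgebra ℚ_[p] a 0), ⟨1, t⟩ = δ * (X ^ 2 - B * Y ^ 2) ∧
        norm (⟨1, t⟩ : QuadraticAlgebra ℚ_[p] a 0) ≠ 0 := by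
    intro t k l h1 h2
    obtain ⟨x₁, y₁, e1⟩ := Padic.exists_eq_sq_sub_mul_sq hp hb1 h1
    obtain ⟨x₂, y₂, e2⟩ := Padic.exists_eq_sq_sub_mul_sq hp hb2 h2
    obtain ⟨X, hX1, hX2⟩ := exists_evalRoot_eq hθ hθ0 x₁ x₂
    obtain ⟨Y, hY1, hY2⟩ := exists_evalRoot_eq hθ hθ0 y₁ y₂
    refine ⟨t, X, Y, eq_of_evalRoot_eq hθ hθ0 ?_ ?_, ?_⟩
    · simp only [map_mul, map_sub, map_pow, hX1, hY1]
      rw [← e1, mul_div_cancel₀ _ hd1, evalRoot_apply]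
    · simp only [map_mul, map_sub, map_pow, hX2, hY2]
      rw [← e2, mul_div_cancel₀ _ hd2, evalRoot_apply]
    · rw [← evalRoot_mul_evalRoot_neg hθ, evalRoot_apply, evalRoot_apply]
      refine mul_ne_zero ?_ ?_
      · intro h; simp only at h; rw [h, zero_div, norm_zero] at h1
        exact zpow_ne_zero _ hpR h1.symm
      · intro h; simp only at h; rw [h, zero_div, norm_zero] at h2
        exact zpow_ne_zero _ hpR h2.symm
  rcases Int.even_or_odd' n with ⟨m, rfl | rfl⟩
  · refine key 0 (-m) m ?_ ?_
    · rw [norm_div, hn, mul_zero, add_zero, norm_one, one_div, ← zpow_neg]; congr 1; ring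
    · rw [norm_div, hn2, mul_zero, add_zero, norm_one, one_div, ← zpow_neg]; congr 1; ring
  -- For odd parity, t is chosen so that 1 + θt = 1/p; then 1 - θt = 2 - 1/p, and both have
  -- valuation -1.
  · have hy1 : 1 + θ * ((1 / p - 1) / θ) = (p : ℚ_[p])⁻¹ := by field_simp; ring
    have hy2 : 1 + -θ * ((1 / p - 1) / θ) = 2 + -(p : ℚ_[p])⁻¹ := by field_simp; ring
    have hpi : ‖(p : ℚ_[p])⁻¹‖ = (p : ℝ) ^ (1 : ℤ) := by simp
    have hp1 : (1 : ℝ) < p := by exact_mod_cast (Fact.out : p.Prime).one_lt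
    have h2 : ‖(2 : ℚ_[p])‖ ≤ 1 := by exact_mod_cast Padic.norm_int_le_one (p := p) 2
    have hpi2 : ‖2 + -(p : ℚ_[p])⁻¹‖ = (p : ℝ) ^ (1 : ℤ) := by
      rw [Padic.add_eq_max_of_ne, norm_neg, hpi, zpow_one, max_eq_right (h2.trans hp1.le)]
      rw [norm_neg, hpi, zpow_one]
      exact (h2.trans_lt hp1).ne
    refine key ((1 / p - 1) / θ) (-m) (m + 1) ?_ ?_
    · rw [hy1, norm_div, hn, hpi, ← zpow_sub₀ hpR]; congr 1; ring
    · rw [hy2, norm_div, hn2, hpi2, ← zpow_sub₀ hpR]; congr 1; ring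

/-- The local equation `1 + t √a = δ X²` is solvable at primes that are inert in `ℚ(√a)` and at
which `a` and the norm of `δ` are units. -/
theorem Padic.exists_sq_of_inert (hp : p ≠ 2) (ha : ‖a‖ = 1) (hns : ¬ IsSquare a)
    {δ : QuadraticAlgebra ℚ_[p] a 0} (hδ : ‖norm δ‖ = 1) :
    ∃ (t : ℚ_[p]) (X : QuadraticAlgebra ℚ_[p] a 0), ⟨1, t⟩ = δ * X ^ 2 ∧
      norm (⟨1, t⟩ : QuadraticAlgebra ℚ_[p] a 0) ≠ 0 := by
  obtain ⟨a, rfl⟩ : ∃ a' : ℤ_[p], (a' : ℚ_[p]) = a := ⟨⟨a, ha.le⟩, rfl⟩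
  rw [← PadicInt.norm_def] at ha
  replace hns : ¬ IsSquare a := fun ⟨y, hy⟩ => hns ⟨y, by rw [hy]; push_cast; rfl⟩
  have ha0 := PadicInt.toZMod_ne_zero_iff.2 ha
  have hns0 : ¬ IsSquare (PadicInt.toZMod a) := fun h =>
    hns (PadicInt.isSquare_of_isSquare_toZMod hp ha0 h)
  have haQ : (a : ℚ_[p]) ≠ 0 := by
    rintro h; rw [PadicInt.norm_def, h, norm_zero] at ha; exact zero_ne_one ha
  have hN0 : norm δ ≠ 0 := by intro h; rw [h, norm_zero] at hδ; exact zero_ne_one hδ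
  -- Every unit z of ℤ_p becomes a square in ℚ_p(√a): either z is a square, or za = g² and z =
  -- ((g/a)√a)².
  have huniv : ∀ z : ℤ_[p], ‖z‖ = 1 → ∃ s : QuadraticAlgebra ℚ_[p] (a : ℚ_[p]) 0,
      norm s ≠ 0 ∧ s ^ 2 = ⟨z, 0⟩ := by
    intro z hz
    have hz0 := PadicInt.toZMod_ne_zero_iff.2 hz
    have hzQ : (z : ℚ_[p]) ≠ 0 := by
      rintro h; rw [PadicInt.norm_def, h, norm_zero] at hz; exact zero_ne_one hz
    by_cases hs : IsSquare (PadicInt.toZMod z)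
    · obtain ⟨g, rfl⟩ := PadicInt.isSquare_of_isSquare_toZMod hp hz0 hs
      push_cast at hzQ
      refine ⟨⟨g, 0⟩, by simpa [norm_def] using hzQ, ?_⟩
      ext <;> simp [sq]
    · have hprod : IsSquare (PadicInt.toZMod (z * a)) := by
        rw [map_mul, ← quadraticChar_one_iff_isSquare (mul_ne_zero hz0 ha0), map_mul,
          quadraticChar_neg_one_iff_not_isSquare.2 hs,
          quadraticChar_neg_one_iff_not_isSquare.2 hns0]
        norm_num
      obtain ⟨g, hg⟩ := PadicInt.isSquare_of_isSquare_toZMod hp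
        (by rw [map_mul]; exact mul_ne_zero hz0 ha0) hprod
      have hg' : (z : ℚ_[p]) * a = g * g := by exact_mod_cast congrArg Subtype.val hg
      have hgQ : (g : ℚ_[p]) ≠ 0 := by
        intro h; rw [h, zero_mul] at hg'; exact mul_ne_zero hzQ haQ hg'
      refine ⟨⟨0, g / a⟩, ?_, ?_⟩
      · simp [norm_def, haQ, hgQ]
      · ext <;> simp [sq]
        field_simp
        linear_combination -hg'
  -- Once δs² has unit rational part z, dividing by z, a square upstairs, makes that part 1.
  have key : ∀ (s : QuadraticAlgebra ℚ_[p] (a : ℚ_[p]) 0) (z : ℤ_[p]), norm s ≠ 0 → ‖z‖ = 1 →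
      (δ * s ^ 2).re = z → ∃ (t : ℚ_[p]) (X : QuadraticAlgebra ℚ_[p] (a : ℚ_[p]) 0),
        ⟨1, t⟩ = δ * X ^ 2 ∧ norm (⟨1, t⟩ : QuadraticAlgebra ℚ_[p] (a : ℚ_[p]) 0) ≠ 0 := by
    intro s z hs hz hre
    obtain ⟨g, hgN, hg⟩ := huniv z hz
    have hzQ : (z : ℚ_[p]) ≠ 0 := by
      rintro h; rw [PadicInt.norm_def, h, norm_zero] at hz; exact zero_ne_one hz
    have hX : (⟨1, (δ * s ^ 2).im / z⟩ : QuadraticAlgebra ℚ_[p] (a : ℚ_[p]) 0) =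
        δ * (s * g * ⟨(z : ℚ_[p])⁻¹, 0⟩) ^ 2 := by
      have : δ * (s * g * ⟨(z : ℚ_[p])⁻¹, 0⟩) ^ 2 =
          (δ * s ^ 2) * (g ^ 2 * ⟨(z : ℚ_[p])⁻¹, 0⟩ ^ 2) := by ring
      rw [this, hg]
      generalize δ * s ^ 2 = w at *
      ext
      · simp [sq, hre]; field_simp
      · simp [sq]; field_simp
    refine ⟨_, _, hX, ?_⟩
    rw [hX]
    simp only [map_mul, map_pow]
    refine mul_ne_zero hN0 (pow_ne_zero _ (mul_ne_zero (mul_ne_zero hs hgN) ?_))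
    simp [norm_def, hzQ]
  have hδN : norm δ = δ.re * δ.re - a * δ.im * δ.im := by simp [norm_def]
  -- δ is integral: otherwise scaling by its larger coordinate gives x² ≡ ay² mod p with x or y
  -- equal to 1, making a a square mod p.
  obtain ⟨α, β, hα, hβ⟩ : ∃ α β : ℤ_[p], (α : ℚ_[p]) = δ.re ∧ (β : ℚ_[p]) = δ.im := by
    have hlt : ∀ m : ℚ_[p], 1 < ‖m‖ → ‖δ.re‖ ≤ ‖m‖ → ‖δ.im‖ ≤ ‖m‖ →
        m = δ.re ∨ m = δ.im → False := by
      intro m hm h1 h2 hmem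
      have hm0 : m ≠ 0 := by rintro rfl; rw [norm_zero] at hm; linarith
      have hint : ∀ u : ℚ_[p], ‖u‖ ≤ ‖m‖ → ∃ w : ℤ_[p], (w : ℚ_[p]) = u / m := fun u hu =>
        ⟨⟨u / m, by rw [norm_div]; exact div_le_one_of_le₀ hu (norm_nonneg _)⟩, rfl⟩
      obtain ⟨x, hx⟩ := hint _ h1
      obtain ⟨y, hy⟩ := hint _ h2
      have hxy : PadicInt.toZMod (x * x - a * y * y) = 0 := by
        rw [PadicInt.toZMod_eq_zero_iff_dvd, ← PadicInt.norm_lt_one_iff_dvd, PadicInt.norm_def]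
        push_cast
        have : (x : ℚ_[p]) * x - a * y * y = norm δ / m ^ 2 := by
          rw [hδN, hx, hy]; field_simp
        rw [this, norm_div, hδ, norm_pow, div_lt_one (by positivity)]
        exact one_lt_pow₀ hm two_ne_zero
      simp only [map_sub, map_mul] at hxy
      by_cases hy0 : PadicInt.toZMod y = 0
      · have hx0 : PadicInt.toZMod x = 0 := by simpa [hy0] using hxy
        have hone : ∀ w : ℤ_[p], (w : ℚ_[p]) = m / m → PadicInt.toZMod w ≠ 0 := fun w hw => by
          have : w = 1 := PadicInt.ext (by rw [hw, div_self hm0, PadicInt.coe_one])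
          simp [this]
        rcases hmem with rfl | rfl
        exacts [hone x hx hx0, hone y hy hy0]
      · exact hns0 ⟨PadicInt.toZMod x / PadicInt.toZMod y, by
          field_simp; linear_combination -hxy⟩
    have hboth : ‖δ.re‖ ≤ 1 ∧ ‖δ.im‖ ≤ 1 := by
      by_contra! hc
      rcases le_total ‖δ.re‖ ‖δ.im‖ with h | h
      · exact hlt δ.im (by by_contra! h'; linarith [hc (h.trans h')]) h le_rfl (.inr rfl)
      · exact hlt δ.re (by by_contra! h'; linarith [hc h']) le_rfl h (.inl rfl)
    exact ⟨⟨_, hboth.1⟩, ⟨_, hboth.2⟩, rfl, rfl⟩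
  have hN : ‖α * α - a * β * β‖ = 1 := by
    rw [PadicInt.norm_def]
    push_cast
    rw [hα, hβ, ← hδN, hδ]
  by_cases h : ‖α‖ = 1
  · exact key 1 α (by simp) h (by simp [hα])
  · have hα0 : PadicInt.toZMod α = 0 := by
      by_contra hc; exact h (PadicInt.toZMod_ne_zero_iff.1 hc)
    have hβ0 : PadicInt.toZMod β ≠ 0 := by
      intro hc
      refine PadicInt.toZMod_ne_zero_iff.2 hN ?_
      simp [hα0, hc]
    -- When p divides α, multiplying by (1 + √a)² gives rational part α(1 + a) + 2aβ, a unit because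
    -- β is.
    refine key ⟨1, 1⟩ (α * (1 + a) + (a * β + a * β)) ?_ ?_ ?_
    · simp [norm_def, sub_eq_zero]
      intro hc
      apply hns
      exact ⟨1, by rw [one_mul]; exact PadicInt.ext hc.symm⟩
    · rw [← PadicInt.toZMod_ne_zero_iff]
      simp only [map_add, map_mul, hα0, zero_mul, zero_add, ← two_mul]
      refine mul_ne_zero ?_ (mul_ne_zero ha0 hβ0)
      rw [map_ofNat]
      exact Ring.two_ne_zero (by rwa [ZMod.ringChar_zmod_n])
    · push_cast
      simp [sq, hα, hβ]
      ring

end Padic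

end

/-! ### Patching the local data into one global δ. -/

section

open Filter Topology
open QuadraticAlgebra hiding norm_neg norm_zero norm_one norm_star

theorem Padic.exists_finset_norm_eq_one {q : ℚ} (hq : q ≠ 0) :
    ∃ T : Finset Nat.Primes, ∀ p ∉ T, ‖(q : ℚ_[(p : ℕ)])‖ = 1 := by
  have h0 : q.num.natAbs * q.den ≠ 0 :=
    mul_ne_zero (Int.natAbs_ne_zero.2 (Rat.num_ne_zero.2 hq)) q.den_ne_zero
  refine ⟨(q.num.natAbs * q.den).primeFactors.subtype Nat.Prime, fun p hp => ?_⟩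
  have hp' : ¬ (p : ℕ) ∣ q.num.natAbs * q.den := fun h =>
    hp (Finset.mem_subtype.2 (Nat.mem_primeFactors.2 ⟨p.2, h, h0⟩))
  rw [Rat.cast_def, norm_div, Padic.norm_natCast_eq_one_iff.2, Padic.norm_intCast_eq_one_iff.2,
    div_one]
  · rw [Int.isCoprime_iff_gcd_eq_one, Int.gcd_eq_natAbs]
    refine Nat.Coprime.symm ?_
    exact (Nat.Prime.coprime_iff_not_dvd p.2).2 fun h => hp' (h.mul_right _)
  · exact (Nat.Prime.coprime_iff_not_dvd p.2).2 fun h => hp' (h.mul_left _)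

theorem Padic.exists_finset_norm_le_one (q : ℚ) :
    ∃ T : Finset Nat.Primes, ∀ p ∉ T, ‖(q : ℚ_[(p : ℕ)])‖ ≤ 1 := by
  by_cases hq : q = 0
  · exact ⟨∅, fun p _ => by simp [hq]⟩
  · obtain ⟨T, hT⟩ := Padic.exists_finset_norm_eq_one hq
    exact ⟨T, fun p hp => (hT p hp).le⟩

/-- The base change `ℚ[√a] → A[√a]`. -/
def QuadraticAlgebra.ratMap (a : ℤ) (A : Type*) [Field A] [CharZero A] :
    QuadraticAlgebra ℚ (a : ℚ) 0 →+* QuadraticAlgebra A (a : A) 0 where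
  toFun z := ⟨z.re, z.im⟩
  map_one' := by ext <;> simp
  map_zero' := by ext <;> simp
  map_add' x y := by ext <;> simp
  map_mul' x y := by ext <;> simp

namespace QuadraticAlgebra

variable {a : ℤ} {A : Type*} [Field A] [CharZero A]

theorem ratMap_apply (z : QuadraticAlgebra ℚ (a : ℚ) 0) :
    ratMap a A z = ⟨z.re, z.im⟩ := rfl

theorem ratMap_star (z : QuadraticAlgebra ℚ (a : ℚ) 0) :
    ratMap a A (star z) = star (ratMap a A z) := by
  ext <;> simp [ratMap_apply]

theorem norm_ratMap (z : QuadraticAlgebra ℚ (a : ℚ) 0) :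
    norm (ratMap a A z) = (norm z : ℚ) := by
  simp [ratMap_apply, norm_def]

theorem norm_mk_zero {R : Type*} [CommRing R] {a : R} (x : R) :
    norm (⟨x, 0⟩ : QuadraticAlgebra R a 0) = x ^ 2 := by
  simp [norm_def, sq]

theorem norm_one_mk {R : Type*} [CommRing R] {a : R} (t : R) :
    norm (⟨1, t⟩ : QuadraticAlgebra R a 0) = 1 - a * t ^ 2 := by
  simp [norm_def]; ring

theorem mul_star_eq_mk {R : Type*} [CommRing R] {a : R} (z : QuadraticAlgebra R a 0) :
    z * star z = ⟨norm z, 0⟩ := by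
  rw [← algebraMap_norm_eq_mul_star, algebraMap_eq]

theorem norm_ne_zero_of_ne_zero (ha : Squarefree a) (ha1 : a ≠ 1)
    {z : QuadraticAlgebra ℚ (a : ℚ) 0} (hz : z ≠ 0) : norm z ≠ 0 := by
  have : Fact (∀ r : ℚ, r ^ 2 ≠ (a : ℚ) + 0 * r) :=
    ⟨fun r => by simpa using Int.not_sq_eq_of_squarefree ha ha1 r⟩
  exact fun h => hz (norm_eq_zero_iff_eq_zero.1 h)

theorem exists_norm_eq_inv_of_local (ha : Squarefree a) (ha1 : a ≠ 1) {c : ℚ} (hc : c ≠ 0)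
    (hloc : ∀ v : RatPlace, ∃ z w : QuadraticAlgebra v.Completion (a : v.Completion) 0,
      norm w ≠ 0 ∧ c * norm w = norm z) :
    ∃ δ : QuadraticAlgebra ℚ (a : ℚ) 0, norm δ = c⁻¹ := by
  obtain ⟨x, y, h⟩ := exists_sq_sub_mul_sq_eq_of_local ha ha1 hc fun v => by
    obtain ⟨z, w, hw, h⟩ := hloc v
    let u := z * star w * ⟨(norm w)⁻¹, 0⟩
    have hu : norm u = c := by
      simp only [u, map_mul, QuadraticAlgebra.norm_star, norm_mk_zero]
      rw [← h]; field_simp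
    refine ⟨u.re, u.im, ?_⟩
    rw [← hu, norm_def]; ring
  refine ⟨⟨x / c, y / c⟩, ?_⟩
  simp only [norm_def]
  field_simp
  linear_combination -h

end QuadraticAlgebra

/-- δ itself need not be a unit at a split prime, as w is uncontrolled there; only its norm is. -/
theorem Padic.exists_relNorm_of_units {p : ℕ} [Fact p.Prime] (hp : p ≠ 2) {a : ℤ}
    (ha : ‖(a : ℚ_[p])‖ = 1) {B δ : QuadraticAlgebra ℚ_[p] (a : ℚ_[p]) 0}
    (hB1 : ‖B.re‖ ≤ 1) (hB2 : ‖B.im‖ ≤ 1) (hB : ‖norm B‖ = 1) (hδ : ‖norm δ‖ = 1) :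
    ∃ (t : ℚ_[p]) (X Y : QuadraticAlgebra ℚ_[p] (a : ℚ_[p]) 0), ⟨1, t⟩ = δ * (X ^ 2 - B * Y ^ 2) ∧
      norm (⟨1, t⟩ : QuadraticAlgebra ℚ_[p] (a : ℚ_[p]) 0) ≠ 0 := by
  by_cases h : IsSquare (a : ℚ_[p])
  · obtain ⟨θ, hθ⟩ := h
    exact Padic.exists_relNorm_of_split hp (θ := θ) (by rw [hθ, sq]) ha hB1 hB2 hB hδ
  · obtain ⟨t, X, h1, h2⟩ := Padic.exists_sq_of_inert hp ha h hδ
    exact ⟨t, X, 0, by simpa using h1, h2⟩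

theorem exists_adelic_relNorm_solution {a : ℤ} (ha : Squarefree a) (ha1 : a ≠ 1) {c : ℚ} (hc : c ≠ 0)
    {B : QuadraticAlgebra ℚ (a : ℚ) 0} (hB : B ≠ 0) (S : Finset RatPlace)
    (t : ∀ v : RatPlace, v.Completion)
    (X Y : ∀ v : RatPlace, QuadraticAlgebra v.Completion (a : v.Completion) 0)
    (hloc : ∀ v : RatPlace,
      (c : v.Completion) * (1 - (a : v.Completion) * t v ^ 2) = QuadraticAlgebra.norm (X v ^ 2 - ratMap a _ B * Y v ^ 2) ∧
      (c : v.Completion) * (1 - (a : v.Completion) * t v ^ 2) ≠ 0)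
    (U : ∀ v : RatPlace, Set (v.Completion × v.Completion)) (hU : ∀ v, U v ∈ 𝓝 (1, 0)) :
    ∃ δ : QuadraticAlgebra ℚ (a : ℚ) 0, norm δ = c⁻¹ ∧
      ∀ v : RatPlace, ∃ (t₀ : v.Completion)
        (X₀ Y₀ : QuadraticAlgebra v.Completion (a : v.Completion) 0),
        ⟨1, t₀⟩ = ratMap a _ δ * (X₀ ^ 2 - ratMap a _ B * Y₀ ^ 2) ∧
        norm (⟨1, t₀⟩ : QuadraticAlgebra v.Completion (a : v.Completion) 0) ≠ 0 ∧
        (v ∈ S → t₀ = t v ∧ ∃ s ∈ U v, X₀ = ⟨s.1, s.2⟩ * X v ∧ Y₀ = ⟨s.1, s.2⟩ * Y v) := by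
  have ha0 : a ≠ 0 := ha.ne_zero
  have hnt : ∀ v : RatPlace, norm (⟨1, t v⟩ : QuadraticAlgebra v.Completion (a : v.Completion) 0) ≠ 0 :=
    fun v => by rw [norm_one_mk]; exact right_ne_zero_of_mul (hloc v).2
  obtain ⟨δ₀, hδ₀⟩ := exists_norm_eq_inv_of_local ha ha1 hc fun v =>
    ⟨X v ^ 2 - ratMap a _ B * Y v ^ 2, (⟨1, t v⟩ : QuadraticAlgebra _ _ _), hnt v, by
      rw [norm_one_mk]; exact (hloc v).1⟩
  obtain ⟨T₁, hT₁⟩ := Padic.exists_finset_norm_eq_one (q := (a : ℚ)) (by exact_mod_cast ha0)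
  obtain ⟨T₂, hT₂⟩ := Padic.exists_finset_norm_eq_one hc
  obtain ⟨T₃, hT₃⟩ := Padic.exists_finset_norm_eq_one (norm_ne_zero_of_ne_zero ha ha1 hB)
  obtain ⟨T₄, hT₄⟩ := Padic.exists_finset_norm_le_one B.re
  obtain ⟨T₅, hT₅⟩ := Padic.exists_finset_norm_le_one B.im
  classical
  -- The set is fixed before w is chosen. Its real place also guarantees that w has nonzero norm.
  let S' : Finset RatPlace := S ∪ {.infinite} ∪
    (T₁ ∪ T₂ ∪ T₃ ∪ T₄ ∪ T₅ ∪ {⟨2, Nat.prime_two⟩}).image .finite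
  let z : ∀ v : RatPlace, QuadraticAlgebra v.Completion (a : v.Completion) 0 := fun v =>
    ratMap a _ δ₀ * (X v ^ 2 - ratMap a _ B * Y v ^ 2) * star ⟨1, t v⟩ *
      ⟨(norm (⟨1, t v⟩ : QuadraticAlgebra v.Completion (a : v.Completion) 0))⁻¹, 0⟩
  have hz : ∀ v, norm (z v) = 1 := fun v => by
    have hcv : (c : v.Completion) ≠ 0 := by exact_mod_cast hc
    have h1 := hnt v
    simp only [z, map_mul, QuadraticAlgebra.norm_star, norm_mk_zero, norm_ratMap, hδ₀, ← (hloc v).1]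
    rw [norm_one_mk] at h1 ⊢
    push_cast
    field_simp
  have hzt : ∀ v, z v * ⟨1, t v⟩ = ratMap a _ δ₀ * (X v ^ 2 - ratMap a _ B * Y v ^ 2) := fun v => by
    have h1 : star (⟨1, t v⟩ : QuadraticAlgebra v.Completion (a : v.Completion) 0) *
        ⟨(norm (⟨1, t v⟩ : QuadraticAlgebra v.Completion (a : v.Completion) 0))⁻¹, 0⟩ *
          ⟨1, t v⟩ = 1 := by
      rw [mul_right_comm, mul_comm (star _), mul_star_eq_mk]
      ext <;> simp [hnt v]
    simp only [z]
    linear_combination (ratMap a _ δ₀ * (X v ^ 2 - ratMap a _ B * Y v ^ 2)) * h1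
  have hw := fun v => RatPlace.exists_eventually_eq_mul_star_mul_sq v (a := (a : v.Completion))
    (by exact_mod_cast ha0) (z v) (hz v) (hU v)
  choose y hy using hw
  obtain ⟨q, r, hqr⟩ := RatPlace.exists_rat_prod_forall_mem S' y _ fun v _ => hy v
  let w : QuadraticAlgebra ℚ (a : ℚ) 0 := ⟨q, r⟩
  have hwv : ∀ v ∈ S', norm (ratMap a v.Completion w) ≠ 0 ∧ ∃ s ∈ U v,
      ratMap a v.Completion w = z v * star (ratMap a v.Completion w) * ⟨s.1, s.2⟩ ^ 2 := hqr
  have hNw : norm w ≠ 0 := by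
    have := (hwv .infinite (by simp [S'])).1
    rw [norm_ratMap] at this
    exact_mod_cast this
  -- This is δ₀σ(w)/w, written with N(w) as the only denominator.
  let δ : QuadraticAlgebra ℚ (a : ℚ) 0 := δ₀ * star w * star w * ⟨(norm w)⁻¹, 0⟩
  have hδw : δ * w = δ₀ * star w := by
    have h1 : star w * ⟨(norm w)⁻¹, 0⟩ * w = 1 := by
      rw [mul_right_comm, mul_comm (star _), mul_star_eq_mk]
      ext <;> simp [hNw]
    simp only [δ]
    linear_combination δ₀ * star w * h1
  have hδ : norm δ = c⁻¹ := by
    simp only [δ, map_mul, QuadraticAlgebra.norm_star, norm_mk_zero, hδ₀]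
    field_simp
  refine ⟨δ, hδ, fun v => ?_⟩
  by_cases hv : v ∈ S'
  · obtain ⟨hNwv, s, hs, hws⟩ := hwv v hv
    refine ⟨t v, ⟨s.1, s.2⟩ * X v, ⟨s.1, s.2⟩ * Y v, ?_, hnt v, fun _ => ⟨rfl, s, hs, rfl, rfl⟩⟩
    have hunit : IsUnit (ratMap a v.Completion w) :=
      isUnit_iff_norm_isUnit.2 (isUnit_iff_ne_zero.2 hNwv)
    apply hunit.mul_left_cancel
    have h1 := congrArg (ratMap a v.Completion) hδw
    simp only [map_mul, ratMap_star] at h1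
    rw [show ratMap a v.Completion w * (ratMap a v.Completion δ *
      ((⟨s.1, s.2⟩ * X v) ^ 2 - ratMap a v.Completion B * (⟨s.1, s.2⟩ * Y v) ^ 2)) =
      (ratMap a v.Completion δ * ratMap a v.Completion w) * ⟨s.1, s.2⟩ ^ 2 *
        (X v ^ 2 - ratMap a v.Completion B * Y v ^ 2) by ring, h1]
    nth_rewrite 1 [hws]
    linear_combination star (ratMap a v.Completion w) * ⟨s.1, s.2⟩ ^ 2 * hzt v
  · cases v with
    | infinite => exact absurd (by simp [S']) hv
    | finite p =>
      simp [S', -Finset.union_assoc] at hv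
      obtain ⟨hvS, hv⟩ := hv
      have hp2 : (p : ℕ) ≠ 2 := fun h => by
        have : p = ⟨2, Nat.prime_two⟩ := Subtype.ext h
        exact hv.2 (Finset.mem_singleton.2 this)
      have hB3 : ‖norm (ratMap a ℚ_[(p : ℕ)] B)‖ = 1 := by
        rw [norm_ratMap]; exact hT₃ p (by tauto)
      have hδ3 : ‖norm (ratMap a ℚ_[(p : ℕ)] δ)‖ = 1 := by
        rw [norm_ratMap, hδ, Rat.cast_inv, norm_inv, hT₂ p (by tauto), inv_one]
      obtain ⟨t₀, X₀, Y₀, h1, h2⟩ := Padic.exists_relNorm_of_units hp2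
        (by simpa using hT₁ p (by tauto)) (hT₄ p (by tauto)) (hT₅ p (by tauto)) hB3 hδ3
      exact ⟨t₀, X₀, Y₀, h1, h2, fun h => absurd h hvS⟩

end

/-! ### Norm forms in explicit coordinates. -/

section

open Filter Topology
open QuadraticAlgebra hiding norm_neg norm_zero norm_one norm_star

section NormForm

variable {F E : Type*} [Field F] [Field E] [Algebra F E] {ι n : Type*} [Fintype ι] [Fintype n]
  [DecidableEq n]

theorem Algebra.leftMulMatrix_tensorProduct_basis {R : Type*} [CommRing R] [Algebra F R]
    (b : Module.Basis n F E) (k : E) :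
    Algebra.leftMulMatrix (Algebra.TensorProduct.basis R b) (1 ⊗ₜ k) =
      (Algebra.leftMulMatrix b k).map (algebraMap F R) := by
  ext i j
  simp [Algebra.leftMulMatrix_eq_repr_mul, Algebra.TensorProduct.basis_apply,
    Algebra.TensorProduct.basis_repr_tmul, Algebra.algebraMap_eq_smul_one]

/-- Multiplication by the generic element has a matrix that is linear in the variables, obtained by
base change from F. -/
theorem normForm_eq_det (b : Module.Basis n F E) (w : ι → E) :
    normForm F w = (∑ i, (MvPolynomial.X i : MvPolynomial ι F) •
      (Algebra.leftMulMatrix b (w i)).map (algebraMap F (MvPolynomial ι F))).det := by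
  rw [normForm, Algebra.norm_eq_matrix_det (Algebra.TensorProduct.basis (MvPolynomial ι F) b),
    map_sum]
  congr 1
  refine Finset.sum_congr rfl fun i _ => ?_
  rw [← Algebra.leftMulMatrix_tensorProduct_basis, ← map_smul, TensorProduct.smul_tmul',
    smul_eq_mul, mul_one]

theorem eval_normForm [FiniteDimensional F E] (w : ι → E) (x : ι → F) :
    MvPolynomial.eval x (normForm F w) = Algebra.norm F (∑ i, x i • w i) := by
  let b := Module.finBasis F E
  rw [normForm_eq_det b, Algebra.norm_eq_matrix_det b, RingHom.map_det]
  congr 1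
  simp only [map_sum, map_smul]
  ext i j
  simp [Matrix.sum_apply]

end NormForm

/-- A quadratic extension `K / L` with an `L`-basis `1, s` such that `s ^ 2 = β`. -/
theorem exists_basis_one_sqrt {L K : Type*} [Field L] [CharZero L] [Field K] [Algebra L K]
    (hK : Module.finrank L K = 2) :
    ∃ (b : Module.Basis (Fin 2) L K) (β : L), b 0 = 1 ∧ b 1 ^ 2 = algebraMap L K β := by
  have : FiniteDimensional L K := FiniteDimensional.of_finrank_eq_succ hK
  obtain ⟨y, hy⟩ : ∃ y : K, y ∉ Set.range (algebraMap L K) := by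
    by_contra! h
    have h1 : Module.finrank L K = 1 := by
      refine finrank_eq_one 1 one_ne_zero fun w => ?_
      obtain ⟨c, hc⟩ := h w
      exact ⟨c, by rw [← hc, Algebra.algebraMap_eq_smul_one]⟩
    omega
  have hli : ∀ z : K, z ∉ Set.range (algebraMap L K) → LinearIndependent L ![1, z] := by
    intro z hz
    rw [LinearIndependent.pair_iff]
    intro u v h
    have hv : v = 0 := by
      by_contra hv
      refine hz ⟨-u / v, ?_⟩
      have hv' : algebraMap L K v ≠ 0 := by simpa using hv
      rw [Algebra.smul_def, Algebra.smul_def, mul_one] at h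
      rw [map_div₀, map_neg, div_eq_iff hv']
      linear_combination -h
    subst hv
    exact ⟨by simpa [Algebra.smul_def] using h, rfl⟩
  let b₀ := basisOfLinearIndependentOfCardEqFinrank (hli y hy) (by simp [hK])
  have hb₀ : ⇑b₀ = ![1, y] := coe_basisOfLinearIndependentOfCardEqFinrank _ _
  have hsq := b₀.sum_repr (y ^ 2)
  rw [Fin.sum_univ_two, hb₀] at hsq
  simp only [Matrix.cons_val_zero, Matrix.cons_val_one, Algebra.smul_def, mul_one] at hsq
  set u := b₀.repr (y ^ 2) 0
  set v := b₀.repr (y ^ 2) 1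
  have h2 : algebraMap L K (v / 2) * 2 = algebraMap L K v := by
    rw [map_div₀, map_ofNat]
    have : CharZero K := charZero_of_injective_algebraMap (algebraMap L K).injective
    field_simp
  -- Completing the square in y² = u + vy.
  have hs : y - algebraMap L K (v / 2) ∉ Set.range (algebraMap L K) := by
    rintro ⟨c, hc⟩
    exact hy ⟨c + v / 2, by rw [map_add, hc]; ring⟩
  refine ⟨basisOfLinearIndependentOfCardEqFinrank (hli _ hs) (by simp [hK]), u + (v / 2) ^ 2, ?_, ?_⟩
  · simp
  · simp only [coe_basisOfLinearIndependentOfCardEqFinrank, Matrix.cons_val_one,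
      Matrix.cons_val_fin_one, map_add, map_pow]
    linear_combination -hsq - y * h2

theorem leftMulMatrix_one_sqrt {L K : Type*} [Field L] [Field K] [Algebra L K]
    (b : Module.Basis (Fin 2) L K) {β : L} (hb0 : b 0 = 1) (hb1 : b 1 ^ 2 = algebraMap L K β) (k : K) :
    Algebra.leftMulMatrix b k =
      !![b.repr k 0, β * b.repr k 1; b.repr k 1, b.repr k 0] := by
  have hk : k = b.repr k 0 • b 0 + b.repr k 1 • b 1 := by
    conv_lhs => rw [← b.sum_repr k, Fin.sum_univ_two]
  have hk1 : k * b 1 = (β * b.repr k 1) • b 0 + b.repr k 0 • b 1 := by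
    conv_lhs => rw [hk]
    simp only [hb0, Algebra.smul_def, map_mul]
    linear_combination algebraMap L K (b.repr k 1) * hb1
  ext i j
  rw [Algebra.leftMulMatrix_eq_repr_mul]
  fin_cases j
  · fin_cases i <;> simp [hb0]
  · simp only [Fin.mk_one, Fin.isValue, hk1]
    fin_cases i <;> simp

/-- The norm form of `L(√β) / L`. -/
theorem normForm_eq_sq_sub {L K : Type*} [Field L] [Field K] [Algebra L K] {ι : Type*} [Fintype ι]
    (b : Module.Basis (Fin 2) L K) {β : L} (hb0 : b 0 = 1) (hb1 : b 1 ^ 2 = algebraMap L K β)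
    (w : ι → K) :
    normForm L w = (∑ i, MvPolynomial.X i * MvPolynomial.C (b.repr (w i) 0)) ^ 2 -
      MvPolynomial.C β * (∑ i, MvPolynomial.X i * MvPolynomial.C (b.repr (w i) 1)) ^ 2 := by
  rw [normForm_eq_det b, Matrix.det_fin_two]
  simp only [leftMulMatrix_one_sqrt b hb0 hb1, Matrix.sum_apply, Matrix.smul_apply,
    Matrix.map_apply, Matrix.of_apply, Matrix.cons_val', Matrix.cons_val_zero, Matrix.cons_val_one,
    Matrix.cons_val_fin_one, MvPolynomial.algebraMap_eq, smul_eq_mul, map_mul]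
  have : ∑ i, MvPolynomial.X i * (MvPolynomial.C β * MvPolynomial.C (b.repr (w i) 1)) =
      MvPolynomial.C β * ∑ i, MvPolynomial.X i * MvPolynomial.C (b.repr (w i) 1) := by
    rw [Finset.mul_sum]; exact Finset.sum_congr rfl fun i _ => by ring
  rw [this]
  ring

namespace QuadraticAlgebra

variable {a : ℤ} {L : Type*} [Field L] [CharZero L]

/-- The isomorphism `ℚ[√a] ≃ L` for `L = ℚ(√a)`. -/
theorem exists_algEquiv [NumberField L] (ha : Squarefree a) (ha1 : a ≠ 1) {r : L}
    (hr : r ^ 2 = (a : L)) (hL : IntermediateField.adjoin ℚ {r} = ⊤) :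
    ∃ φ : QuadraticAlgebra ℚ (a : ℚ) 0 ≃ₐ[ℚ] L, ∀ z, φ z = (z.re : L) + z.im * r := by
  let f : QuadraticAlgebra ℚ (a : ℚ) 0 →ₐ[ℚ] L := lift ⟨r, by
    rw [← sq, hr]; simp [Algebra.smul_def]⟩
  have hf : ∀ z, f z = (z.re : L) + z.im * r := fun z => by
    change z.re • (1 : L) + z.im • r = _
    simp [Algebra.smul_def]
  have hinj : Function.Injective f := by
    rw [injective_iff_map_eq_zero]
    intro z hz
    by_contra hz0
    have h1 := congrArg f (mul_star_eq_mk z)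
    rw [map_mul, hz, zero_mul, hf] at h1
    simp at h1
    exact norm_ne_zero_of_ne_zero ha ha1 hz0 (by exact_mod_cast h1.symm)
  have hsurj : Function.Surjective f := by
    have h1 := IntermediateField.adjoin_simple_toSubalgebra_of_isAlgebraic
      (Algebra.IsAlgebraic.isAlgebraic (R := ℚ) r)
    rw [hL, IntermediateField.top_toSubalgebra] at h1
    rw [← AlgHom.range_eq_top, eq_top_iff, h1]
    refine Algebra.adjoin_le ?_
    rintro _ rfl
    exact ⟨ω, (hf _).trans (by simp)⟩
  exact ⟨AlgEquiv.ofBijective f ⟨hinj, hsurj⟩, hf⟩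

theorem algebra_norm_eq (z : QuadraticAlgebra ℚ (a : ℚ) 0) : Algebra.norm ℚ z = norm z := by
  rw [← det_toLinearMap_eq_norm]
  rfl

/-- The homomorphism `A[√a] → L ⊗ A` for `r = √a ∈ L`. -/
def toTensor {r : L} (hr : r ^ 2 = (a : L)) (A : Type*) [Field A] [CharZero A] :
    QuadraticAlgebra A (a : A) 0 →+* L ⊗[ℚ] A where
  toFun z := 1 ⊗ₜ z.re + r ⊗ₜ z.im
  map_one' := by simp [Algebra.TensorProduct.one_def]
  map_zero' := by simp
  map_add' x y := by simp [TensorProduct.tmul_add]; abel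
  map_mul' x y := by
    have h : (r * r) ⊗ₜ[ℚ] (x.im * y.im) = 1 ⊗ₜ[ℚ] ((a : A) * x.im * y.im) := by
      rw [← sq, hr, show (a : L) = (a : ℚ) • 1 by simp [Algebra.smul_def],
        TensorProduct.smul_tmul, mul_assoc]
      simp [Algebra.smul_def]
    simp only [re_mul, im_mul, mul_add, add_mul, Algebra.TensorProduct.tmul_mul_tmul, one_mul,
      mul_one, zero_mul, add_zero, TensorProduct.tmul_add, h]
    abel

variable {r : L} (hr : r ^ 2 = (a : L)) {A : Type*} [Field A] [CharZero A]

theorem toTensor_apply (z : QuadraticAlgebra A (a : A) 0) :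
    toTensor hr A z = 1 ⊗ₜ z.re + r ⊗ₜ z.im := rfl

theorem toTensor_ratMap (z : QuadraticAlgebra ℚ (a : ℚ) 0) :
    toTensor hr A (ratMap a A z) = ((z.re : L) + z.im * r) ⊗ₜ 1 := by
  have h : ∀ (q : ℚ) (u : L), (q * u) ⊗ₜ[ℚ] (1 : A) = u ⊗ₜ (q : A) := fun q u => by
    rw [show (q : L) * u = q • u by simp [Algebra.smul_def], TensorProduct.smul_tmul]
    simp [Algebra.smul_def]
  rw [toTensor_apply, ratMap_apply, TensorProduct.add_tmul, h, ← h _ 1, mul_one]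

end QuadraticAlgebra

end

/-! ### Rational change of coordinates between x and (X, Y). -/

section

open Filter Topology
open QuadraticAlgebra hiding norm_neg norm_zero norm_one norm_star

namespace QuadraticAlgebra

variable {a : ℤ} {ι : Type*} [Fintype ι]

/-- The linear form with coefficients `P i ∈ ℚ[√a]`, as a map from `A`-valued vectors to `A[√a]`. -/
def linearForm (P : ι → QuadraticAlgebra ℚ (a : ℚ) 0) {A : Type*} [Field A] [CharZero A]
    (x : ι → A) : QuadraticAlgebra A (a : A) 0 :=
  ∑ i, x i • ratMap a A (P i)

variable {A : Type*} [Field A] [CharZero A] (P Q : ι → QuadraticAlgebra ℚ (a : ℚ) 0)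

theorem re_linearForm (x : ι → A) : (linearForm P x).re = ∑ i, x i * ((P i).re : A) := by
  have := map_sum (reₗ _ _ : QuadraticAlgebra A (a : A) 0 →ₗ[A] A) (fun i => x i • ratMap a A (P i))
    Finset.univ
  exact this

theorem im_linearForm (x : ι → A) : (linearForm P x).im = ∑ i, x i * ((P i).im : A) := by
  have := map_sum (imₗ _ _ : QuadraticAlgebra A (a : A) 0 →ₗ[A] A) (fun i => x i • ratMap a A (P i))
    Finset.univ
  exact this

/-- The coordinates of a pair of elements of `A[√a]`. -/
def pairCoords {A : Type*} [Field A] (X Y : QuadraticAlgebra A (a : A) 0) : Fin 2 × Fin 2 → A :=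
  fun ij => ![![X.re, Y.re], ![X.im, Y.im]] ij.1 ij.2

theorem pairCoords_injective {A : Type*} [Field A] {X Y X' Y' : QuadraticAlgebra A (a : A) 0}
    (h : pairCoords X Y = pairCoords X' Y') : X = X' ∧ Y = Y' :=
  ⟨QuadraticAlgebra.ext (congrFun h (0, 0)) (congrFun h (1, 0)),
    QuadraticAlgebra.ext (congrFun h (0, 1)) (congrFun h (1, 1))⟩

/-- A single polynomial for all `A` reduces the comparison of norms to rational points. -/
theorem exists_polynomial_norm (B : QuadraticAlgebra ℚ (a : ℚ) 0) :
    ∃ E : MvPolynomial ι ℚ, ∀ (A : Type) [Field A] [CharZero A] (x : ι → A),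
      MvPolynomial.aeval x E = norm (linearForm P x ^ 2 - ratMap a A B * linearForm Q x ^ 2) := by
  let f : (ι → ℚ) → MvPolynomial ι ℚ := fun c => ∑ i, MvPolynomial.X i * MvPolynomial.C (c i)
  let p₀ := f fun i => (P i).re
  let p₁ := f fun i => (P i).im
  let q₀ := f fun i => (Q i).re
  let q₁ := f fun i => (Q i).im
  let u := p₀ * p₀ + MvPolynomial.C (a : ℚ) * p₁ * p₁ - (MvPolynomial.C B.re *
    (q₀ * q₀ + MvPolynomial.C (a : ℚ) * q₁ * q₁) + MvPolynomial.C (a : ℚ) * MvPolynomial.C B.im *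
      (q₀ * q₁ + q₁ * q₀))
  let w := p₀ * p₁ + p₁ * p₀ - (MvPolynomial.C B.re * (q₀ * q₁ + q₁ * q₀) +
    MvPolynomial.C B.im * (q₀ * q₀ + MvPolynomial.C (a : ℚ) * q₁ * q₁))
  refine ⟨u * u - MvPolynomial.C (a : ℚ) * w * w, fun A _ _ x => ?_⟩
  have hf : ∀ c, MvPolynomial.aeval x (f c) = ∑ i, x i * (c i : A) := fun c => by
    simp [f]
  simp only [norm_def, sq, re_sub, im_sub, re_mul, im_mul, re_linearForm, im_linearForm,
    ratMap_apply, u, w, p₀, p₁, q₀, q₁, map_sub, map_add, map_mul, hf, MvPolynomial.aeval_C,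
    eq_ratCast, Rat.cast_intCast]
  ring

end QuadraticAlgebra

variable {a : ℤ} {L K : Type*} [Field L] [NumberField L] [Field K] [Algebra L K] {ι : Type*} [Fintype ι]

theorem algebra_norm_eq_sq_sub {L K : Type*} [Field L] [Field K] [Algebra L K]
    (b : Module.Basis (Fin 2) L K) {β : L} (hb0 : b 0 = 1)
    (hb1 : b 1 ^ 2 = algebraMap L K β) (k : K) :
    Algebra.norm L k = b.repr k 0 ^ 2 - β * b.repr k 1 ^ 2 := by
  rw [Algebra.norm_eq_matrix_det b, leftMulMatrix_one_sqrt b hb0 hb1, Matrix.det_fin_two_of]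
  ring

theorem aeval_normForm_rat [NumberField K] (φ : QuadraticAlgebra ℚ (a : ℚ) 0 ≃ₐ[ℚ] L)
    (b : Module.Basis (Fin 2) L K) {β : L} (hb0 : b 0 = 1) (hb1 : b 1 ^ 2 = algebraMap L K β)
    (w : ι → K) {A : Type} [Field A] [CharZero A] (x : ι → A) :
    MvPolynomial.aeval x (normForm ℚ w) =
      norm (linearForm (fun i => φ.symm (b.repr (w i) 0)) x ^ 2 - ratMap a A (φ.symm β) *
        linearForm (fun i => φ.symm (b.repr (w i) 1)) x ^ 2) := by
  obtain ⟨E, hE⟩ := exists_polynomial_norm (fun i => φ.symm (b.repr (w i) 0))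
    (fun i => φ.symm (b.repr (w i) 1)) (φ.symm β)
  have hEw : normForm ℚ w = E := by
    -- ℚ is infinite, so equality at rational points suffices; there it is transitivity of the norm
    -- in K/L/ℚ.
    refine MvPolynomial.funext fun y => ?_
    have hid : ∀ z : QuadraticAlgebra ℚ (a : ℚ) 0, ratMap a ℚ z = z := fun z => by
      ext <;> simp [ratMap_apply]
    have hlin : ∀ j, φ (linearForm (fun i => φ.symm (b.repr (w i) j)) y) =
        b.repr (∑ i, y i • w i) j := fun j => by
      have h1 : ∀ i, b.repr (y i • w i) = (y i : L) • b.repr (w i) := fun i => by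
        rw [← map_smul]; congr 1; simp [Algebra.smul_def]
      simp only [linearForm, hid, map_sum, map_smul, AlgEquiv.apply_symm_apply,
        Finsupp.finsetSum_apply, h1, Finsupp.smul_apply, smul_eq_mul]
      exact Finset.sum_congr rfl fun i _ => by simp [Algebra.smul_def]
    have h2 : MvPolynomial.eval y E = _ := (congrArg (fun f : ℚ →+* ℚ => MvPolynomial.eval₂ f y E)
      (Subsingleton.elim _ _)).trans (hE ℚ y)
    rw [h2, eval_normForm, ← Algebra.norm_norm (S := L), algebra_norm_eq_sq_sub b hb0 hb1,
      ← algebra_norm_eq, ← Algebra.norm_eq_of_algEquiv φ]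
    congr 1
    simp only [map_sub, map_mul, map_pow, hlin, hid, AlgEquiv.apply_symm_apply]
  rw [hEw, hE]

theorem aeval_normForm_tensor {r : L} (hr : r ^ 2 = (a : L))
    (φ : QuadraticAlgebra ℚ (a : ℚ) 0 ≃ₐ[ℚ] L) (hφ : ∀ z, φ z = (z.re : L) + z.im * r)
    (b : Module.Basis (Fin 2) L K) {β : L} (hb0 : b 0 = 1) (hb1 : b 1 ^ 2 = algebraMap L K β)
    (w : ι → K) {A : Type} [Field A] [CharZero A] (x : ι → A) :
    MvPolynomial.aeval (fun i => (1 : L) ⊗ₜ[ℚ] x i : ι → L ⊗[ℚ] A) (normForm L w) =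
      toTensor hr A (linearForm (fun i => φ.symm (b.repr (w i) 0)) x ^ 2 - ratMap a A (φ.symm β) *
        linearForm (fun i => φ.symm (b.repr (w i) 1)) x ^ 2) := by
  have h1 : ∀ z : L, toTensor hr A (ratMap a A (φ.symm z)) = z ⊗ₜ 1 := fun z => by
    rw [toTensor_ratMap, ← hφ, AlgEquiv.apply_symm_apply]
  have h2 : ∀ y : A, ∀ z : QuadraticAlgebra A (a : A) 0,
      toTensor hr A (y • z) = (1 ⊗ₜ y) * toTensor hr A z := fun y z => by
    simp [toTensor_apply, mul_add]
  simp only [normForm_eq_sq_sub b hb0 hb1, linearForm, map_sub, map_mul, map_pow, map_sum, h1, h2,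
    MvPolynomial.aeval_X, MvPolynomial.aeval_C, Algebra.TensorProduct.algebraMap_apply,
    Algebra.algebraMap_self, RingHom.id_apply]

/-- The passage from x to (X, Y) is a change of ℚ-basis of K, from ω to the products of 1, √a with
`b`. The inverse matrix is therefore rational and works over every `A`; it turns solutions (X, Y)
back into vectors x. -/
theorem exists_linearForm_inverse [NumberField K] (φ : QuadraticAlgebra ℚ (a : ℚ) 0 ≃ₐ[ℚ] L)
    (b : Module.Basis (Fin 2) L K) [DecidableEq ι] (w : Module.Basis ι ℚ K) :
    ∃ G : Matrix ι (Fin 2 × Fin 2) ℚ, ∀ (A : Type) [Field A] [CharZero A],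
      (∀ X Y : QuadraticAlgebra A (a : A) 0,
        linearForm (fun i => φ.symm (b.repr (w i) 0))
          ((G.map (Rat.castHom A)).mulVec (pairCoords X Y)) = X ∧
        linearForm (fun i => φ.symm (b.repr (w i) 1))
          ((G.map (Rat.castHom A)).mulVec (pairCoords X Y)) = Y) ∧
      ∀ x : ι → A, (G.map (Rat.castHom A)).mulVec
        (pairCoords (linearForm (fun i => φ.symm (b.repr (w i) 0)) x)
          (linearForm (fun i => φ.symm (b.repr (w i) 1)) x)) = x := by
  let e : Module.Basis (Fin 2 × Fin 2) ℚ K :=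
    ((QuadraticAlgebra.basis (a : ℚ) 0).map φ.toLinearEquiv).smulTower b
  have he : ∀ k ij, e.repr k ij =
      ![(φ.symm (b.repr k ij.2)).re, (φ.symm (b.repr k ij.2)).im] ij.1 := fun k ij => by
    rw [Module.Basis.smulTower_repr, Module.Basis.map_repr, LinearEquiv.trans_apply,
      basis_repr_apply]
    rfl
  refine ⟨w.toMatrix e, fun A _ _ => ?_⟩
  have hM : ∀ x : ι → A, ((e.toMatrix w).map (Rat.castHom A)).mulVec x =
      pairCoords (linearForm (fun i => φ.symm (b.repr (w i) 0)) x)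
        (linearForm (fun i => φ.symm (b.repr (w i) 1)) x) := fun x => by
    ext ⟨i, j⟩
    simp only [Matrix.mulVec, dotProduct, Matrix.map_apply, Module.Basis.toMatrix_apply, he,
      pairCoords]
    fin_cases i <;> fin_cases j <;>
      simp [re_linearForm, im_linearForm, mul_comm]
  refine ⟨fun X Y => ?_, fun x => ?_⟩
  · apply pairCoords_injective
    rw [← hM, Matrix.mulVec_mulVec, ← Matrix.map_mul, Module.Basis.toMatrix_mul_toMatrix_flip]
    simp
  · rw [← hM, Matrix.mulVec_mulVec, ← Matrix.map_mul, Module.Basis.toMatrix_mul_toMatrix_flip]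
    simp

end

theorem lemma1p3
    (a : ℤ) (ha : Squarefree a) (ha1 : a ≠ 1) (c : ℚ) (hc : c ≠ 0)
    {L K : Type*} [Field L] [NumberField L] [Field K] [NumberField K] [Algebra L K]
    (r : L) (hr : r ^ 2 = (a : L)) (hL : IntermediateField.adjoin ℚ {r} = ⊤)
    (hK : Module.finrank L K = 2) (ω : Module.Basis (Fin 4) ℚ K)
    (S : Finset RatPlace) (ε : ℝ) (hε : 0 < ε)
    (t : ∀ v : RatPlace, v.Completion) (x : ∀ v : RatPlace, Fin 4 → v.Completion)
    (hloc : ∀ v : RatPlace, IsNormSolution a c ω (t v) (x v)) :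
    ∃ δ : L, c = (Algebra.norm ℚ δ)⁻¹ ∧
      ∃ (t₀ : ∀ v : RatPlace, v.Completion) (x₀ : ∀ v : RatPlace, Fin 4 → v.Completion),
        (∀ v : RatPlace, IsRelNormSolution r δ ω (t₀ v) (x₀ v)) ∧
        ∀ v ∈ S, ‖t v - t₀ v‖ < ε ∧ ‖x v - x₀ v‖ < ε := by
  obtain ⟨φ, hφ⟩ := QuadraticAlgebra.exists_algEquiv ha ha1 hr hL
  obtain ⟨b, β, hb0, hb1⟩ := exists_basis_one_sqrt hK
  have hβ : φ.symm β ≠ 0 := by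
    rw [Ne, EmbeddingLike.map_eq_zero_iff]
    rintro rfl
    rw [map_zero] at hb1
    exact b.ne_zero 1 (pow_eq_zero_iff two_ne_zero |>.1 hb1)
  obtain ⟨G, hG⟩ := exists_linearForm_inverse φ b ω
  let X := fun v => QuadraticAlgebra.linearForm (fun i => φ.symm (b.repr (ω i) 0)) (x v)
  let Y := fun v => QuadraticAlgebra.linearForm (fun i => φ.symm (b.repr (ω i) 1)) (x v)
  let ξ : ∀ v : RatPlace, QuadraticAlgebra v.Completion (a : v.Completion) 0 →
      QuadraticAlgebra v.Completion (a : v.Completion) 0 → Fin 4 → v.Completion := fun v X Y =>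
    (G.map (Rat.castHom v.Completion)).mulVec (QuadraticAlgebra.pairCoords X Y)
  -- The multipliers s for which s·x stays within ε of x: an open condition that holds at s = 1.
  let U : ∀ v : RatPlace, Set (v.Completion × v.Completion) := fun v =>
    {s | ‖x v - ξ v (⟨s.1, s.2⟩ * X v) (⟨s.1, s.2⟩ * Y v)‖ < ε}
  have hU : ∀ v, U v ∈ nhds (1, 0) := fun v => by
    have hcont : Continuous fun s : v.Completion × v.Completion =>
        ‖x v - ξ v (⟨s.1, s.2⟩ * X v) (⟨s.1, s.2⟩ * Y v)‖ := by
      refine (continuous_const.sub ?_).norm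
      refine Continuous.matrix_mulVec continuous_const (continuous_pi ?_)
      rintro ⟨i, j⟩
      fin_cases i <;> fin_cases j <;> simp [QuadraticAlgebra.pairCoords] <;> fun_prop
    refine (isOpen_lt hcont continuous_const).mem_nhds ?_
    have h1 : (⟨1, 0⟩ : QuadraticAlgebra v.Completion (a : v.Completion) 0) = 1 := rfl
    simp only [Set.mem_ofPred_eq, h1, one_mul, ξ, X, Y, (hG v.Completion).2, sub_self, norm_zero, hε]
  obtain ⟨δ, hδ, hsol⟩ := exists_adelic_relNorm_solution ha ha1 hc hβ S t X Y
    (fun v => ⟨(hloc v).1.trans (aeval_normForm_rat φ b hb0 hb1 ω (x v)), (hloc v).2⟩) U hU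
  choose t₀ X₀ Y₀ hrel hunit happrox using hsol
  refine ⟨φ δ, ?_, t₀, fun v => ξ v (X₀ v) (Y₀ v), fun v => ?_, fun v hv => ?_⟩
  · rw [Algebra.norm_eq_of_algEquiv, QuadraticAlgebra.algebra_norm_eq, hδ, inv_inv]
  · have hone : QuadraticAlgebra.toTensor hr v.Completion ⟨1, t₀ v⟩ = 1 + r ⊗ₜ t₀ v := rfl
    refine ⟨?_, ?_⟩
    · rw [aeval_normForm_tensor hr φ hφ b hb0 hb1, ((hG v.Completion).1 _ _).1,
        ((hG v.Completion).1 _ _).2, hφ, ← QuadraticAlgebra.toTensor_ratMap hr, ← map_mul,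
        ← hrel, hone]
    · rw [← hone]
      exact (QuadraticAlgebra.isUnit_iff_norm_isUnit.2 (isUnit_iff_ne_zero.2 (hunit v))).map _
  · obtain ⟨ht, s, hs, hX, hY⟩ := happrox v hv
    refine ⟨by rw [ht, sub_self, norm_zero]; exact hε, ?_⟩
    simp only [hX, hY]
    exact hs
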